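/- Fix an integer $m\ge 1$ and real numbers $\gamma_1,\gamma_2,C_0>0$. There is a constant $K>0$, depending only on $m,\gamma_1,\gamma_2,C_0$, with the following property. Let $N\ge 16$ be an integer, let $1/2\le\sigma_L<1$ and $0<\delta<7(1-\sigma_L)$ (so $\delta<7/2$), and write $s=\sigma+it$. For every prime $p$ let $c_1(p),\dots,c_m(p)$ be complex numbers with $|c_j(p)|\le 1$, and let $L(s)$ be a function such that (i) $L(s)=\prod_p\prod_{j=1}^m(1-c_j(p)p^{-s})^{-1}$ for $\sigma>1$, and $L$ is (by continuation) holomorphic for $\sigma\ge\sigma_L$; (ii) $L$ has no zero in $$D_{\delta,N}=\{s:\sigma\ge 1\}\cup\{s: 1-\delta/7\le\sigma<1,\ |t|\le 2(\log N)^3\};$$ (iii) $|L(s)|\le C_0N^{\gamma_1}(1+|t|)^{\gamma_2}$ for $\sigma_L<\sigma<4$. Put $d_p(\ell)=\sum_{j=1}^m c_j(p)^\ell$ and, for $\alpha>1/2$, $C(\alpha)=\sum_p\sum_{\ell=2}^\infty \frac{d_p(\ell)}{\ell p^{\ell\alpha}}$. Then $L$ has a holomorphic logarithm $\log L$ on $D_{\delta,N}$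 which satisfies $\log L(s)=\sum_p\sum_{\ell=1}^\infty\frac{d_p(\ell)}{\ell p^{\ell s}}$ for $\sigma>1$; it is unique. For all real $y$ and $a$ with $(\log N)^{14/\delta}\le y\le N^{2\pi/5}$ and $0\le 28a<\delta\log y$, $$\log L\Big(1-\frac{a}{\log y}\Big)=\sum_{p\le y}\frac{d_p(1)}{p^{1-a/\log y}}+C\Big(1-\frac{a}{\log y}\Big)+R,$$ where $$|R|\le K\left(\frac{e^a}{\log y}+\frac{(\log N)^2}{(\log\log N)(\log N)^{14/\delta}}+\frac{y^{1+\delta/14}(\log N)^{\delta/14+3/2}}{\delta^2N^{\pi/2}}+\frac{e^a\log N}{\delta^3y^{\delta/14}\log y}\right).$$ -/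

import Mathlib

noncomputable section

namespace GeneralLFunction

/-- `d_p(ℓ) = ∑_{j=1}^m c_j(p)^ℓ`. -/
def d {m : ℕ} (c : Fin m → ℕ → ℂ) (p ℓ : ℕ) : ℂ :=
  ∑ j : Fin m, c j p ^ ℓ

/-- `L` is given by the Euler product of degree `m` with coefficients `c_j(p)`, `|c_j(p)| ≤ 1`,
in the half plane of absolute convergence `σ > 1`. -/
structure HasEulerProduct {m : ℕ} (c : Fin m → ℕ → ℂ) (L : ℂ → ℂ) : Prop where
  norm_coeff_le : ∀ (j : Fin m) (p : ℕ), p.Prime → ‖c j p‖ ≤ 1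
  hasProd : ∀ s : ℂ, 1 < s.re →
    HasProd (fun p : Nat.Primes => ∏ j : Fin m, (1 - c j (p : ℕ) * ((p : ℕ) : ℂ) ^ (-s))⁻¹) (L s)

/-- `L` is holomorphic in the closed half plane `σ ≥ σ_L`, where `1/2 ≤ σ_L < 1`. -/
structure HasContinuation (σL : ℝ) (L : ℂ → ℂ) : Prop where
  half_le : 1 / 2 ≤ σL
  lt_one : σL < 1
  analytic : AnalyticOnNhd ℂ L {s : ℂ | σL ≤ s.re}

/-- The region `D_{δ,N}`: the half plane `σ ≥ 1` together with the rectangle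
`1 - δ/7 ≤ σ < 1`, `|t| ≤ 2 (log N)^3`. -/
def region (δ : ℝ) (N : ℕ) : Set ℂ :=
  {s : ℂ | 1 ≤ s.re} ∪
    {s : ℂ | 1 - δ / 7 ≤ s.re ∧ s.re < 1 ∧ |s.im| ≤ 2 * Real.log N ^ 3}

/-- `0 < δ < 7 (1 - σ_L)`, and `L` has no zero in `D_{δ,N}`. -/
structure IsZeroFree (σL δ : ℝ) (N : ℕ) (L : ℂ → ℂ) : Prop where
  pos : 0 < δ
  lt : δ < 7 * (1 - σL)
  ne_zero : ∀ s ∈ region δ N, L s ≠ 0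

/-- `|L(s)| ≤ C₀ N^{γ₁} (1 + |t|)^{γ₂}` for `σ_L < σ < 4`. -/
def HasConvexityBound (γ₁ γ₂ C₀ σL : ℝ) (N : ℕ) (L : ℂ → ℂ) : Prop :=
  ∀ s : ℂ, σL < s.re → s.re < 4 →
    ‖L s‖ ≤ C₀ * (N : ℝ) ^ γ₁ * (1 + |s.im|) ^ γ₂

/-- `logL` is the function `log L` on `D_{δ,N}`: the holomorphic logarithm of `L` there which for
`σ > 1` equals `∑_p ∑_{ℓ ≥ 1} d_p(ℓ) / (ℓ p^{ℓ s})`. (The inner index is shifted by one.) -/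
structure IsLogOf {m : ℕ} (c : Fin m → ℕ → ℂ) (δ : ℝ) (N : ℕ) (L logL : ℂ → ℂ) : Prop where
  holomorphic : DifferentiableOn ℂ logL (region δ N)
  exp_eq : ∀ s ∈ region δ N, Complex.exp (logL s) = L s
  eq_series : ∀ s : ℂ, 1 < s.re →
    logL s = ∑' p : Nat.Primes, ∑' k : ℕ,
      d c p (k + 1) / (((k + 1 : ℕ) : ℂ) * ((p : ℕ) : ℂ) ^ (((k + 1 : ℕ) : ℂ) * s))

/-- `C(α) = ∑_p ∑_{ℓ ≥ 2} d_p(ℓ) / (ℓ p^{ℓ α})`, which converges absolutely for `α > 1/2`.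
(The inner index is shifted by two.) -/
def C {m : ℕ} (c : Fin m → ℕ → ℂ) (α : ℝ) : ℂ :=
  ∑' p : Nat.Primes, ∑' k : ℕ,
    d c p (k + 2) / (((k + 2 : ℕ) : ℂ) * ((((p : ℕ) : ℝ) ^ (((k + 2 : ℕ) : ℝ) * α) : ℝ) : ℂ))

/-- `∑_{p ≤ y} d_p(1) / p^α`. -/
def primeSum {m : ℕ} (c : Fin m → ℕ → ℂ) (y α : ℝ) : ℂ :=
  ∑ p ∈ (Finset.Icc 1 ⌊y⌋₊).filter Nat.Prime, d c p 1 / ((((p : ℝ) ^ α : ℝ)) : ℂ)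

/-- The expression inside the `O`-symbol. -/
def errorTerm (δ : ℝ) (N : ℕ) (y a : ℝ) : ℝ :=
  Real.exp a / Real.log y
    + Real.log N ^ 2 / (Real.log (Real.log N) * Real.log N ^ (14 / δ))
    + y ^ (1 + δ / 14) * Real.log N ^ (δ / 14 + 3 / 2) / (δ ^ 2 * (N : ℝ) ^ (Real.pi / 2))
    + Real.exp a * Real.log N / (δ ^ 3 * y ^ (δ / 14) * Real.log y)

end GeneralLFunction

end

/-!
The Dirichlet series of `log L` is smoothed by the Riesz weight `max (1 - n / y) 0` at a constant
scale. Removing the weight from the primes costs at most `y⁻¹ ∑_{p ≤ y} m p ^ (1 - α)`, which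
Chebyshev's bound makes `O(e ^ a / log y)` at `α = 1 - a / log y`; proper prime powers contribute
far less (`norm_riesz_sub_le`). It remains to compare the Riesz mean of the series with
`log L(α)`.

The weight has Mellin transform `1 / (w (w + 1))`, so Mellin inversion expresses the Riesz mean as
an integral of `log L(z) y ^ w / (w (w + 1))`, `w = z - α`, over the line `σ = 1 + 1 / log y`
(`hasSum_riesz_logTerm`). The same integral with `log L(z)` replaced by the constant `log L(α)` is
`(1 - 1 / y) log L(α)`. The difference of the two has an integrand without pole at `z = α`, and
its part with `|t| ≤ (log N) ^ 3` is moved to the line `σ = 1 - 3 δ / 28` by Cauchy's theorem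
(`norm_integral_rieszKernel_sub_le`). As the kernel decays like `t⁻²`, the tails and the
horizontal segments at height `(log N) ^ 3` are `O(e ^ a / log N)`, hence `O(e ^ a / log y)`.

On the rectangle `log L ≪ (log N) / δ`, by the Borel-Carathéodory theorem on the discs of radius
`1 + δ / 7` about `2 + i t`, in which `Re log L = log |L| ≪ log N` by the convexity bound
(`norm_log_le`). The new line is to the left of `σ = 1 - δ / 14`, and the surplus factor
`y ^ (-δ / 28) ≤ 28 / (δ log y)` produces the denominator `δ³ log y` of the last error term.
The hypotheses on `y` force `1 / δ ≪ log N`, so powers of `1 / δ` in the other terms are harmless.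
Only the first and the last of the four error terms are needed.

The holomorphic logarithm exists because the region is the union of two closed convex sets with a
common point, on each of which `L' / L` has a primitive (`exists_primitive_union`).
-/

noncomputable section

open Complex Set MeasureTheory Filter Topology

namespace GeneralLFunction

variable {m : ℕ} {c : Fin m → ℕ → ℂ}

/-! ### Sums over prime powers -/

/-- The prime power `p ^ (k + 1)` indexed by the pair `(p, k)`. -/
def primePow (x : Nat.Primes × ℕ) : ℕ := (x.1 : ℕ) ^ (x.2 + 1)

lemma primePow_pos (x : Nat.Primes × ℕ) : 0 < primePow x := pow_pos x.1.2.pos _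

lemma one_le_primePow (x : Nat.Primes × ℕ) : (1 : ℝ) ≤ primePow x := by
  exact_mod_cast primePow_pos x

lemma primePow_injective : Function.Injective primePow := by
  intro x y h
  apply Nat.Primes.prodNatEquiv.injective
  ext
  exact h

lemma summable_primePow_rpow_neg {σ : ℝ} (hσ : 1 < σ) :
    Summable fun x => (primePow x : ℝ) ^ (-σ) :=
  (Real.summable_nat_rpow.2 (by linarith)).comp_injective primePow_injective

lemma tsum_nat_rpow_neg_le {σ : ℝ} (hσ : 1 < σ) :
    ∑' n : ℕ, (n : ℝ) ^ (-σ) ≤ 1 + 1 / (σ - 1) := by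
  have h := ZetaAsymptotics.zeta_limit_aux1 hσ
  have h2 : 0 ≤ ZetaAsymptotics.termTSum σ :=
    tsum_nonneg fun n => ZetaAsymptotics.term_nonneg (n + 1) σ
  have h3 : 0 ≤ σ * ZetaAsymptotics.termTSum σ := mul_nonneg (by linarith) h2
  rw [(Real.summable_nat_rpow.2 (by linarith : -σ < -1)).tsum_eq_zero_add]
  have h4 : ∀ n : ℕ, ((n + 1 : ℕ) : ℝ) ^ (-σ) = 1 / (n + 1 : ℝ) ^ σ := fun n => by
    rw [Real.rpow_neg (by positivity)]; simp
  simp only [h4, Nat.cast_zero, Real.zero_rpow (by linarith : -σ ≠ 0)]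
  linarith

lemma tsum_primePow_rpow_neg_le {σ : ℝ} (hσ : 1 < σ) :
    ∑' x, (primePow x : ℝ) ^ (-σ) ≤ 1 + 1 / (σ - 1) := by
  refine le_trans ?_ (tsum_nat_rpow_neg_le hσ)
  exact (summable_primePow_rpow_neg hσ).tsum_le_tsum_of_inj primePow primePow_injective
    (fun n _ => by positivity) (fun _ => le_rfl) (Real.summable_nat_rpow.2 (by linarith))

/-- The sum over proper prime powers converges already for exponents larger than `1/2`. -/
lemma summable_primePow_succ_rpow_neg {θ : ℝ} (hθ : 1 / 2 < θ) :
    Summable fun x : Nat.Primes × ℕ => (primePow (x.1, x.2 + 1) : ℝ) ^ (-θ) := by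
  have h1 : Summable fun p : Nat.Primes => ((p : ℕ) : ℝ) ^ (-(2 * θ)) :=
    (Real.summable_nat_rpow.2 (by linarith)).comp_injective Subtype.val_injective
  have h2 : Summable fun k : ℕ => ((2 : ℝ) ^ (-θ)) ^ k :=
    summable_geometric_of_lt_one (by positivity)
      (Real.rpow_lt_one_of_one_lt_of_neg (by norm_num) (by linarith))
  refine Summable.of_nonneg_of_le (fun x => by positivity) (fun x => ?_)
    (h1.mul_of_nonneg h2 (fun _ => by positivity) (fun _ => by positivity))
  have hp : (2 : ℝ) ≤ ((x.1 : ℕ) : ℝ) := by exact_mod_cast x.1.2.two_le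
  have hp0 : (0 : ℝ) < ((x.1 : ℕ) : ℝ) := by linarith
  have : (primePow (x.1, x.2 + 1) : ℝ) ^ (-θ)
      = ((x.1 : ℕ) : ℝ) ^ (-(2 * θ)) * (((x.1 : ℕ) : ℝ) ^ (-θ)) ^ x.2 := by
    simp only [primePow, Nat.cast_pow]
    rw [← Real.rpow_natCast, ← Real.rpow_natCast, ← Real.rpow_mul hp0.le, ← Real.rpow_mul hp0.le,
      ← Real.rpow_add hp0]
    congr 1
    push_cast
    ring
  rw [this]
  exact mul_le_mul_of_nonneg_left (pow_le_pow_left₀ (by positivity)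
    (Real.rpow_le_rpow_of_nonpos (by norm_num) hp (by linarith)) _) (by positivity)

/-- Chebyshev's upper bound for the number of primes up to `y`. -/
lemma primeCounting_floor_le {y : ℝ} (hy : 1 < y) :
    (Nat.primeCounting ⌊y⌋₊ : ℝ) ≤ 8 * y / Real.log y := by
  have hl : 0 < Real.log y := Real.log_pos hy
  refine (Chebyshev.pi_le_log4_mul_div hy).trans ?_
  rw [Real.log_sqrt (by linarith)]
  have hs : Real.sqrt y * Real.sqrt y = y := Real.mul_self_sqrt (by linarith)
  have h4 : Real.log 4 ≤ 2 := by
    rw [show (4 : ℝ) = 2 ^ 2 by norm_num, Real.log_pow]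
    have := Real.log_two_lt_d9; norm_num; linarith
  have h5 : Real.log y ≤ 2 * Real.sqrt y := by
    have := Real.log_le_self (Real.sqrt_nonneg y)
    rw [Real.log_sqrt (by linarith)] at this
    linarith
  have h6 : Real.sqrt y ≤ 2 * y / Real.log y := by
    rw [le_div_iff₀ hl]
    nlinarith [Real.sqrt_nonneg y]
  have h7 : Real.log 4 * y / (Real.log y / 2) ≤ 4 * y / Real.log y := by
    rw [div_div_eq_mul_div]
    gcongr ?_ / _
    nlinarith
  have h8 : 4 * y / Real.log y + 2 * y / Real.log y ≤ 8 * y / Real.log y := by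
    rw [← add_div]; gcongr ?_ / _; linarith
  linarith

lemma norm_d_le (hc : ∀ (j : Fin m) (p : ℕ), p.Prime → ‖c j p‖ ≤ 1)
    {p : ℕ} (hp : p.Prime) (l : ℕ) : ‖d c p l‖ ≤ m := by
  refine (norm_sum_le _ _).trans ?_
  calc ∑ j, ‖c j p ^ l‖ ≤ ∑ _j : Fin m, (1 : ℝ) := by
        gcongr with j
        rw [norm_pow]
        exact pow_le_one₀ (norm_nonneg _) (hc j p hp)
    _ = m := by simp

/-! ### The Dirichlet series of the logarithm -/

/-- The term of the Dirichlet series of `log L` at the prime power `p ^ (k + 1)`. -/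
def logTerm (c : Fin m → ℕ → ℂ) (x : Nat.Primes × ℕ) (s : ℂ) : ℂ :=
  d c x.1 (x.2 + 1) / ((x.2 + 1 : ℕ) : ℂ) * (primePow x : ℂ) ^ (-s)

/-- The Dirichlet series of `log L`, summed over all prime powers at once. -/
def logSeries (c : Fin m → ℕ → ℂ) (s : ℂ) : ℂ := ∑' x, logTerm c x s

lemma norm_logCoeff_le (hc : ∀ (j : Fin m) (p : ℕ), p.Prime → ‖c j p‖ ≤ 1)
    (x : Nat.Primes × ℕ) : ‖d c x.1 (x.2 + 1) / ((x.2 + 1 : ℕ) : ℂ)‖ ≤ m := by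
  rw [norm_div, Complex.norm_natCast]
  refine (div_le_self (norm_nonneg _) ?_).trans (norm_d_le hc x.1.2 _)
  exact_mod_cast Nat.le_add_left 1 x.2

lemma norm_logTerm_le (hc : ∀ (j : Fin m) (p : ℕ), p.Prime → ‖c j p‖ ≤ 1)
    (x : Nat.Primes × ℕ) (s : ℂ) : ‖logTerm c x s‖ ≤ m * (primePow x : ℝ) ^ (-s.re) := by
  rw [logTerm, norm_mul, Complex.norm_natCast_cpow_of_pos (primePow_pos x), neg_re]
  exact mul_le_mul_of_nonneg_right (norm_logCoeff_le hc x) (by positivity)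

lemma summable_logTerm (hc : ∀ (j : Fin m) (p : ℕ), p.Prime → ‖c j p‖ ≤ 1)
    {s : ℂ} (hs : 1 < s.re) : Summable fun x => logTerm c x s :=
  Summable.of_norm_bounded ((summable_primePow_rpow_neg hs).mul_left _)
    fun x => norm_logTerm_le hc x s

lemma norm_logSeries_le (hc : ∀ (j : Fin m) (p : ℕ), p.Prime → ‖c j p‖ ≤ 1)
    {s : ℂ} (hs : 1 < s.re) : ‖logSeries c s‖ ≤ m * (1 + 1 / (s.re - 1)) := by
  refine (tsum_of_norm_bounded ((summable_primePow_rpow_neg hs).mul_left _).hasSum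
    fun x => norm_logTerm_le hc x s).trans ?_
  rw [tsum_mul_left]
  gcongr
  exact tsum_primePow_rpow_neg_le hs

lemma primePow_cpow_neg (x : Nat.Primes × ℕ) (s : ℂ) :
    (primePow x : ℂ) ^ (-s) = (((x.1 : ℕ) : ℂ) ^ (-s)) ^ (x.2 + 1) := by
  rw [primePow, Nat.cast_pow, ← Complex.natCast_cpow_natCast_mul, mul_comm, Complex.cpow_mul_nat]

lemma logSeries_eq (hc : ∀ (j : Fin m) (p : ℕ), p.Prime → ‖c j p‖ ≤ 1)
    {s : ℂ} (hs : 1 < s.re) :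
    logSeries c s = ∑' p : Nat.Primes, ∑' k : ℕ,
      d c p (k + 1) / (((k + 1 : ℕ) : ℂ) * ((p : ℕ) : ℂ) ^ (((k + 1 : ℕ) : ℂ) * s)) := by
  rw [logSeries, (summable_logTerm hc hs).tsum_prod]
  refine tsum_congr fun p => tsum_congr fun k => ?_
  rw [logTerm, primePow_cpow_neg, Complex.cpow_nat_mul, Complex.cpow_neg, inv_pow,
    div_mul_eq_div_div]
  rfl

lemma differentiableOn_logSeries (hc : ∀ (j : Fin m) (p : ℕ), p.Prime → ‖c j p‖ ≤ 1) :
    DifferentiableOn ℂ (logSeries c) {s | 1 < s.re} := by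
  intro s hs
  have hs' : 1 < s.re := hs
  set σ := (1 + s.re) / 2 with hσ
  have hU : IsOpen {z : ℂ | σ < z.re} := isOpen_lt continuous_const Complex.continuous_re
  have hd : DifferentiableOn ℂ (fun z => ∑' x, logTerm c x z) {z : ℂ | σ < z.re} := by
    refine Complex.differentiableOn_tsum_of_summable_norm
      ((summable_primePow_rpow_neg (by linarith : 1 < σ)).mul_left (m : ℝ)) (fun x => ?_) hU
      fun x z hz => (norm_logTerm_le hc x z).trans ?_
    · have : (primePow x : ℂ) ≠ 0 := by exact_mod_cast (primePow_pos x).ne'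
      refine DifferentiableOn.const_mul (fun z _ => ?_) _
      exact ((differentiableAt_id.neg).const_cpow (Or.inl this)).differentiableWithinAt
    · have hz' : σ < z.re := hz
      gcongr
      exact one_le_primePow x
  exact (hd.differentiableAt (hU.mem_nhds
    (by simp only [mem_ofPred_eq]; linarith))).differentiableWithinAt

lemma norm_coeff_mul_cpow_neg_lt_one (hc : ∀ (j : Fin m) (p : ℕ), p.Prime → ‖c j p‖ ≤ 1)
    {s : ℂ} (hs : 0 < s.re) (j : Fin m) (p : Nat.Primes) :
    ‖c j p * ((p : ℕ) : ℂ) ^ (-s)‖ < 1 := by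
  rw [norm_mul, Complex.norm_natCast_cpow_of_pos p.2.pos, neg_re]
  have h1 : ((p : ℕ) : ℝ) ^ (-s.re) < 1 :=
    Real.rpow_lt_one_of_one_lt_of_neg (by exact_mod_cast p.2.one_lt) (by linarith)
  have h2 : 0 ≤ ((p : ℕ) : ℝ) ^ (-s.re) := by positivity
  nlinarith [hc j p p.2, norm_nonneg (c j p)]

lemma hasSum_logTerm_prime (hc : ∀ (j : Fin m) (p : ℕ), p.Prime → ‖c j p‖ ≤ 1)
    {s : ℂ} (hs : 0 < s.re) (p : Nat.Primes) :
    HasSum (fun k => logTerm c (p, k) s)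
      (∑ j, -Complex.log (1 - c j p * ((p : ℕ) : ℂ) ^ (-s))) := by
  have h : ∀ j, HasSum (fun k : ℕ => (c j p * ((p : ℕ) : ℂ) ^ (-s)) ^ (k + 1) / ((k + 1 : ℕ) : ℂ))
      (-Complex.log (1 - c j p * ((p : ℕ) : ℂ) ^ (-s))) := fun j => by
    have := (hasSum_nat_add_iff' 1).2
      (Complex.hasSum_taylorSeries_neg_log (norm_coeff_mul_cpow_neg_lt_one hc hs j p))
    simpa using this
  convert hasSum_sum fun j (_ : j ∈ Finset.univ) => h j using 2 with k
  rw [logTerm, primePow_cpow_neg, d, Finset.sum_div, Finset.sum_mul]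
  refine Finset.sum_congr rfl fun j _ => ?_
  rw [mul_pow]; ring

lemma exp_logSeries {L : ℂ → ℂ} (hL : HasEulerProduct c L) {s : ℂ} (hs : 1 < s.re) :
    Complex.exp (logSeries c s) = L s := by
  have hc := hL.norm_coeff_le
  have h1 := (summable_logTerm hc hs).hasSum.prod_fiberwise
    fun p => hasSum_logTerm_prime hc (by linarith : 0 < s.re) p
  refine h1.cexp.unique ?_
  convert hL.hasProd s hs using 2 with p
  rw [Function.comp_apply, Complex.exp_sum]
  refine Finset.prod_congr rfl fun j _ => ?_
  have hne : 1 - c j p * ((p : ℕ) : ℂ) ^ (-s) ≠ 0 := by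
    rw [sub_ne_zero]
    intro h
    have h1 := norm_coeff_mul_cpow_neg_lt_one hc (by linarith : 0 < s.re) j p
    rw [← h, norm_one] at h1
    exact lt_irrefl _ h1
  rw [Complex.exp_neg, Complex.exp_log hne]

/-! ### Existence of the holomorphic logarithm -/

lemma eq_of_hasDerivWithinAt_zero {f : ℂ → ℂ} {s : Set ℂ} (hs : Convex ℝ s)
    (hf : ∀ z ∈ s, HasDerivWithinAt f 0 s z) {z w : ℂ} (hz : z ∈ s) (hw : w ∈ s) : f z = f w := by
  have := hs.norm_image_sub_le_of_norm_hasDerivWithin_le (C := 0) hf (by simp) hw hz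
  rw [zero_mul, norm_le_zero_iff, sub_eq_zero] at this
  exact this

lemma hasDerivWithinAt_of_notMem_closed {f : ℂ → ℂ} {f' z : ℂ} {s : Set ℂ} (hs : IsClosed s)
    (hz : z ∉ s) : HasDerivWithinAt f f' s z :=
  hasDerivWithinAt_iff_hasFDerivWithinAt.2 <|
    HasFDerivWithinAt.of_notMem_closure (by rwa [hs.closure_eq])

/-- A function that is holomorphic on the union of two closed convex sets with a common point has
a primitive there: the primitives on the two sets differ by a constant on the (convex)
intersection. -/
lemma exists_primitive_union {A B : Set ℂ} (hA : Convex ℝ A) (hB : Convex ℝ B) (hA' : IsClosed A)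
    (hB' : IsClosed B) {w : ℂ} (hw : w ∈ A ∩ B) {f : ℂ → ℂ} (hf : DifferentiableOn ℂ f (A ∪ B)) :
    ∃ g : ℂ → ℂ, ∀ z ∈ A ∪ B, HasDerivWithinAt g (f z) (A ∪ B) z := by
  classical
  obtain ⟨gA, hgA⟩ := hA.exists_forall_hasDerivWithinAt (hf.mono subset_union_left)
  obtain ⟨gB, hgB⟩ := hB.exists_forall_hasDerivWithinAt (hf.mono subset_union_right)
  let g : ℂ → ℂ := fun z => if z ∈ A then gA z else gB z + (gA w - gB w)
  have hgA' : ∀ z ∈ A, g z = gA z := fun z hz => if_pos hz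
  have hgB' : ∀ z ∈ B, g z = gB z + (gA w - gB w) := fun z hz => by
    by_cases hzA : z ∈ A
    · have h := eq_of_hasDerivWithinAt_zero (f := fun z => gA z - gB z) (hA.inter hB)
        (fun u hu => by
          have h' := ((hgA u hu.1).mono inter_subset_left).fun_sub
            ((hgB u hu.2).mono inter_subset_right)
          rwa [sub_self] at h') ⟨hzA, hz⟩ hw
      rw [hgA' z hzA, ← h]; ring
    · exact if_neg hzA
  refine ⟨g, fun z _ => HasDerivWithinAt.union ?_ ?_⟩
  · by_cases hz : z ∈ A
    · exact (hgA z hz).congr hgA' (hgA' z hz)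
    · exact hasDerivWithinAt_of_notMem_closed hA' hz
  · by_cases hz : z ∈ B
    · exact ((hgB z hz).add_const _).congr hgB' (hgB' z hz)
    · exact hasDerivWithinAt_of_notMem_closed hB' hz

/-- The half strip `σ ≥ 1 - δ/7`, `|t| ≤ 2 (log N)^3`. -/
def halfStrip (δ : ℝ) (N : ℕ) : Set ℂ :=
  {s : ℂ | 1 - δ / 7 ≤ s.re} ∩ {s : ℂ | |s.im| ≤ 2 * Real.log N ^ 3}

lemma region_eq_union (δ : ℝ) (N : ℕ) : region δ N = {s : ℂ | 1 ≤ s.re} ∪ halfStrip δ N := by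
  ext s
  simp only [region, halfStrip, mem_union, mem_ofPred_eq, mem_inter_iff]
  constructor
  · rintro (h | ⟨h1, -, h3⟩)
    · exact Or.inl h
    · exact Or.inr ⟨h1, h3⟩
  · rintro (h | ⟨h1, h3⟩)
    · exact Or.inl h
    · rcases le_or_gt 1 s.re with h | h
      · exact Or.inl h
      · exact Or.inr ⟨h1, h, h3⟩

lemma isClosed_halfStrip (δ : ℝ) (N : ℕ) : IsClosed (halfStrip δ N) :=
  (isClosed_le continuous_const Complex.continuous_re).inter
    (isClosed_le Complex.continuous_im.abs continuous_const)

lemma convex_halfStrip (δ : ℝ) (N : ℕ) : Convex ℝ (halfStrip δ N) := by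
  refine (convex_halfSpace_re_ge _).inter ?_
  simp only [abs_le, ofPred_and]
  exact (convex_halfSpace_im_ge _).inter (convex_halfSpace_im_le _)

lemma region_subset {σL δ : ℝ} {N : ℕ} (hδ : 0 < δ) (h : δ < 7 * (1 - σL)) :
    region δ N ⊆ {s : ℂ | σL ≤ s.re} := by
  intro s hs
  rw [region_eq_union] at hs
  rcases hs with hs | hs
  · have : 1 ≤ s.re := hs
    simp only [mem_ofPred_eq]; linarith
  · have : 1 - δ / 7 ≤ s.re := hs.1
    simp only [mem_ofPred_eq]; linarith

lemma exists_isLogOf {σL δ : ℝ} {N : ℕ} {L : ℂ → ℂ} (hE : HasEulerProduct c L)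
    (hC : HasContinuation σL L) (hZ : IsZeroFree σL δ N L) :
    ∃ logL : ℂ → ℂ, IsLogOf c δ N L logL := by
  have hc := hE.norm_coeff_le
  have hana : ∀ z ∈ region δ N, AnalyticAt ℂ L z := fun z hz =>
    hC.analytic z (region_subset hZ.pos hZ.lt hz)
  have hA : Convex ℝ {s : ℂ | 1 ≤ s.re} := convex_halfSpace_re_ge 1
  have hA' : IsClosed {s : ℂ | 1 ≤ s.re} := isClosed_le continuous_const Complex.continuous_re
  have h2A : (2 : ℂ) ∈ {s : ℂ | 1 ≤ s.re} := by simp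
  have h2B : (2 : ℂ) ∈ halfStrip δ N := by
    refine ⟨?_, ?_⟩
    · simp only [mem_ofPred_eq, re_ofNat]; linarith [hZ.pos]
    · simp only [mem_ofPred_eq, im_ofNat, abs_zero]
      have := Real.log_natCast_nonneg N
      positivity
  have hf : DifferentiableOn ℂ (fun z => deriv L z / L z) (region δ N) := fun z hz =>
    ((hana z hz).deriv.differentiableAt.div (hana z hz).differentiableAt
      (hZ.ne_zero z hz)).differentiableWithinAt
  obtain ⟨g, hg⟩ := exists_primitive_union hA (convex_halfStrip δ N) hA' (isClosed_halfStrip δ N)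
    ⟨h2A, h2B⟩ (region_eq_union δ N ▸ hf)
  rw [← region_eq_union] at hg
  let F : ℂ → ℂ := fun z => g z + (logSeries c 2 - g 2)
  have hF : ∀ z ∈ region δ N, HasDerivWithinAt F (deriv L z / L z) (region δ N) z :=
    fun z hz => (hg z hz).add_const _
  have hF2 : F 2 = logSeries c 2 := by simp [F]
  -- `L exp(-F)` has derivative zero, hence is constant on both convex pieces of the region
  have hq : ∀ z ∈ region δ N,
      HasDerivWithinAt (fun z => L z * Complex.exp (-F z)) 0 (region δ N) z := fun z hz => by
    refine ((hana z hz).differentiableAt.hasDerivAt.hasDerivWithinAt.fun_mul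
      ((hF z hz).fun_neg.cexp)).congr_deriv ?_
    have h := mul_div_cancel₀ (deriv L z) (hZ.ne_zero z hz)
    linear_combination -Complex.exp (-F z) * h
  have hq2 : L 2 * Complex.exp (-F 2) = 1 := by
    rw [hF2, ← exp_logSeries hE (by simp : 1 < (2 : ℂ).re), ← Complex.exp_add, add_neg_cancel,
      Complex.exp_zero]
  have hq1 : ∀ z ∈ region δ N, L z * Complex.exp (-F z) = 1 := fun z hz => by
    have hsub := region_eq_union δ N
    rw [← hq2]
    rw [hsub] at hz
    rcases hz with hz | hz
    · exact eq_of_hasDerivWithinAt_zero (f := fun z => L z * Complex.exp (-F z)) hA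
        (fun u hu => (hq u (hsub ▸ Or.inl hu)).mono (hsub ▸ subset_union_left)) hz h2A
    · exact eq_of_hasDerivWithinAt_zero (f := fun z => L z * Complex.exp (-F z))
        (convex_halfStrip δ N)
        (fun u hu => (hq u (hsub ▸ Or.inr hu)).mono (hsub ▸ subset_union_right)) hz h2B
  refine ⟨F, fun z hz => (hF z hz).differentiableWithinAt, fun z hz => ?_, fun s hs => ?_⟩
  · have := hq1 z hz
    rw [Complex.exp_neg, mul_inv_eq_one₀ (Complex.exp_ne_zero _)] at this
    exact this.symm
  · rw [← logSeries_eq hc hs]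
    have hU : IsOpen {z : ℂ | 1 < z.re} := isOpen_lt continuous_const Complex.continuous_re
    have hUr : {z : ℂ | 1 < z.re} ⊆ region δ N := fun z (hz : 1 < z.re) => Or.inl hz.le
    have hconst : ∀ z ∈ {z : ℂ | 1 < z.re},
        HasDerivWithinAt (fun z => F z - logSeries c z) 0 {z : ℂ | 1 < z.re} z := fun z hz => by
      have hS := ((differentiableOn_logSeries hc).differentiableAt (hU.mem_nhds hz)).hasDerivAt
      have hS' : HasDerivAt L (Complex.exp (logSeries c z) * deriv (logSeries c) z) z :=
        hS.cexp.congr_of_eventuallyEq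
          (eventuallyEq_of_mem (hU.mem_nhds hz) fun u hu => (exp_logSeries hE hu).symm)
      refine (((hF z (hUr hz)).mono hUr).fun_sub hS.hasDerivWithinAt).congr_deriv ?_
      rw [hS'.deriv, ← exp_logSeries hE hz, mul_div_cancel_left₀ _ (Complex.exp_ne_zero _),
        sub_self]
    have h := eq_of_hasDerivWithinAt_zero (convex_halfSpace_re_gt 1) hconst hs
      (by simp : (2 : ℂ) ∈ {z : ℂ | 1 < z.re})
    simp only [hF2, sub_self] at h
    exact sub_eq_zero.1 h

/-! ### The Riesz kernel -/

/-- The kernel `y ^ w / (w (w + 1))`, whose inverse Mellin transform is the Riesz weight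
`max (1 - 1 / y) 0`. -/
def rieszKernel (y : ℝ) (w : ℂ) : ℂ := (y : ℂ) ^ w / (w * (w + 1))

lemma le_norm_mul_add_one {u r t : ℝ} (hu : 0 ≤ u) (hu1 : u ≤ 1) (hur : u ≤ |r|)
    (hr : -1 / 2 ≤ r) :
    u / 2 * (1 + t ^ 2) ≤ ‖((r : ℂ) + t * I) * ((r : ℂ) + t * I + 1)‖ := by
  rw [← pow_le_pow_iff_left₀ (by positivity) (norm_nonneg _) two_ne_zero, norm_mul,
    mul_pow ‖(r : ℂ) + t * I‖,
    Complex.sq_norm, Complex.sq_norm, Complex.normSq_apply, Complex.normSq_apply]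
  simp only [add_re, ofReal_re, mul_re, I_re, mul_zero, ofReal_im, I_im, mul_one, sub_self,
    add_zero, add_im, mul_im, zero_add, one_re, one_im]
  have h1 : u ^ 2 ≤ r ^ 2 := by rw [← sq_abs r]; gcongr
  have h2 : u ^ 2 * (1 + t ^ 2) ≤ r * r + t * t := by
    have : u ^ 2 ≤ 1 := pow_le_one₀ hu hu1
    nlinarith [sq_nonneg t]
  have h3 : 1 / 4 * (1 + t ^ 2) ≤ (r + 1) * (r + 1) + t * t := by nlinarith [sq_nonneg t]
  calc (u / 2 * (1 + t ^ 2)) ^ 2 = (u ^ 2 * (1 + t ^ 2)) * (1 / 4 * (1 + t ^ 2)) := by ring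
    _ ≤ _ := mul_le_mul h2 h3 (by positivity) (by nlinarith)

lemma norm_rieszKernel_le {y u r : ℝ} (hy : 0 < y) (hu : 0 < u) (hu1 : u ≤ 1) (hur : u ≤ |r|)
    (hr : -1 / 2 ≤ r) (t : ℝ) :
    ‖rieszKernel y (r + t * I)‖ ≤ 2 / u * y ^ r * (1 + t ^ 2)⁻¹ := by
  rw [rieszKernel, norm_div, Complex.norm_cpow_eq_rpow_re_of_pos hy]
  have h := le_norm_mul_add_one (t := t) hu.le hu1 hur hr
  simp only [add_re, ofReal_re, mul_re, I_re, mul_zero, ofReal_im, I_im, mul_one, sub_self,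
    add_zero]
  calc y ^ r / _ ≤ y ^ r / (u / 2 * (1 + t ^ 2)) := by gcongr
    _ = _ := by field_simp

/-- Away from the real axis the kernel is small like `t⁻²`, without loss near `w = 0`. -/
lemma norm_rieszKernel_le_inv_sq {y r t : ℝ} (hy : 0 < y) (ht : t ≠ 0) :
    ‖rieszKernel y (r + t * I)‖ ≤ y ^ r * (t ^ 2)⁻¹ := by
  rw [rieszKernel, norm_div, Complex.norm_cpow_eq_rpow_re_of_pos hy, norm_mul]
  have h1 : |t| ≤ ‖(r : ℂ) + t * I‖ := by simpa using Complex.abs_im_le_norm ((r : ℂ) + t * I)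
  have h2 : |t| ≤ ‖(r : ℂ) + t * I + 1‖ := by
    simpa using Complex.abs_im_le_norm ((r : ℂ) + t * I + 1)
  simp only [add_re, ofReal_re, mul_re, I_re, mul_zero, ofReal_im, I_im, mul_one, sub_self,
    add_zero]
  have ht' : 0 < |t| := abs_pos.2 ht
  rw [← sq_abs, sq, ← div_eq_mul_inv]
  gcongr

lemma continuous_rieszKernel_line {y r : ℝ} (hy : 0 < y) (hr0 : r ≠ 0) (hr : -1 / 2 ≤ r) :
    Continuous fun t : ℝ => rieszKernel y (r + t * I) := by
  have hy' : (y : ℂ) ≠ 0 := by exact_mod_cast hy.ne'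
  unfold rieszKernel
  refine Continuous.div ?_ (by fun_prop) fun t h => ?_
  · exact Continuous.const_cpow (by fun_prop) (Or.inl hy')
  · rcases mul_eq_zero.1 h with h | h
    · have := congrArg Complex.re h
      simp at this
      exact hr0 this
    · have := congrArg Complex.re h
      simp at this
      linarith

lemma integrable_rieszKernel_line {y r : ℝ} (hy : 0 < y) (hr : 0 < r) :
    Integrable fun t : ℝ => rieszKernel y (r + t * I) := by
  refine Integrable.mono' (integrable_inv_one_add_sq.const_mul (2 / min r 1 * y ^ r))
    (continuous_rieszKernel_line hy hr.ne' (by linarith)).aestronglyMeasurable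
    (Eventually.of_forall fun t => ?_)
  exact norm_rieszKernel_le hy (lt_min hr one_pos) (min_le_right _ _)
    ((min_le_left _ _).trans (le_abs_self r)) (by linarith) t

/-- Mellin inversion for the Riesz weight. -/
lemma integral_rieszKernel_line {y r : ℝ} (hy : 0 < y) (hr : 0 < r) :
    ∫ t : ℝ, rieszKernel y (r + t * I) = 2 * Real.pi * ((max (1 - 1 / y) 0 : ℝ) : ℂ) := by
  let f : ℝ → ℂ := fun t => indicator (Ioc 0 1) (fun _ => (1 : ℂ)) t
    - indicator (Ioc 0 1) (fun t : ℝ => (t : ℂ) ^ (1 : ℂ)) t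
  have hM : ∀ s : ℂ, 0 < s.re → HasMellin f s (1 / (s * (s + 1))) := fun s hs => by
    have h1 := hasMellin_one_Ioc hs
    have h2 := hasMellin_cpow_Ioc (1 : ℂ) (s := s) (by simp; linarith)
    have h3 := hasMellin_sub h1.1 h2.1
    refine ⟨h3.1, h3.2.trans ?_⟩
    rw [h1.2, h2.2]
    have hs0 : s ≠ 0 := by rintro rfl; simp at hs
    have hs1 : s + 1 ≠ 0 := fun h => by
      have := congrArg Complex.re h
      simp at this; linarith
    field_simp
    ring
  have hf : ∀ t : ℝ, 0 < t → f t = ((max (1 - t) 0 : ℝ) : ℂ) := fun t ht => by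
    simp only [f, indicator, mem_Ioc, ht, true_and, cpow_one]
    split_ifs with h
    · rw [max_eq_left (by linarith)]; push_cast; rfl
    · rw [max_eq_right (by linarith)]; simp
  have hline : ∀ t : ℝ, mellin f (r + t * I) = 1 / (((r : ℂ) + t * I) * ((r : ℂ) + t * I + 1)) :=
    fun t => (hM _ (by simpa using hr)).2
  have hint : Complex.VerticalIntegrable (mellin f) r := by
    have := integrable_rieszKernel_line one_pos hr
    simpa [Complex.VerticalIntegrable, hline, rieszKernel] using this
  have hcont : ContinuousAt f y⁻¹ := by
    have : ContinuousAt (fun t : ℝ => ((max (1 - t) 0 : ℝ) : ℂ)) y⁻¹ :=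
      (by fun_prop : Continuous fun t : ℝ => ((max (1 - t) 0 : ℝ) : ℂ)).continuousAt
    refine this.congr ?_
    filter_upwards [lt_mem_nhds (inv_pos.2 hy)] with t ht using (hf t ht).symm
  have h := mellinInv_mellin_eq r f (inv_pos.2 hy) (hM r (by simpa using hr)).1 hint hcont
  rw [hf _ (inv_pos.2 hy), mellinInv] at h
  have hk : ∀ t : ℝ, ((y⁻¹ : ℝ) : ℂ) ^ (-((r : ℂ) + t * I)) • mellin f (r + t * I)
      = rieszKernel y (r + t * I) := fun t => by
    have harg : (y : ℂ).arg ≠ Real.pi := by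
      rw [Complex.arg_ofReal_of_nonneg hy.le]; exact Real.pi_pos.ne
    rw [hline, rieszKernel, ofReal_inv, Complex.inv_cpow _ _ harg, Complex.cpow_neg, inv_inv,
      smul_eq_mul, mul_one_div]
  simp only [hk] at h
  rw [one_div y, ← h, Complex.real_smul]
  push_cast
  rw [← mul_assoc, mul_one_div_cancel (by simp), one_mul]

lemma mul_rieszKernel_eq {y q : ℝ} (hy : 0 < y) (hq : 0 < q) (α κ : ℂ) :
    (q : ℂ) ^ (-κ) * rieszKernel y (κ - α) = (q : ℂ) ^ (-α) * rieszKernel (y / q) (κ - α) := by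
  have hq' : (q : ℂ) ≠ 0 := by exact_mod_cast hq.ne'
  have h : (y : ℂ) ^ (κ - α) = ((y / q : ℝ) : ℂ) ^ (κ - α) * (q : ℂ) ^ (κ - α) := by
    rw [← Complex.mul_cpow_ofReal_nonneg (by positivity) hq.le, ← ofReal_mul,
      div_mul_cancel₀ _ hq.ne']
  have h2 : (q : ℂ) ^ (-κ) * (q : ℂ) ^ (κ - α) = (q : ℂ) ^ (-α) := by
    rw [← Complex.cpow_add _ _ hq']; congr 1; ring
  rw [rieszKernel, rieszKernel, h, ← h2]
  ring

/-- Perron's formula for Riesz means of the Dirichlet series of `log L`. -/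
lemma hasSum_riesz_logTerm (hc : ∀ (j : Fin m) (p : ℕ), p.Prime → ‖c j p‖ ≤ 1)
    {y α κ : ℝ} (hy : 0 < y) (hκ : 1 < κ) (hα : α < κ) :
    HasSum (fun x => 2 * Real.pi * (logTerm c x α * ((max (1 - primePow x / y) 0 : ℝ) : ℂ)))
      (∫ t : ℝ, logSeries c (κ + t * I) * rieszKernel y ((κ - α : ℝ) + t * I)) := by
  have hr : 0 < κ - α := by linarith
  set B := 2 / min (κ - α) 1 * y ^ (κ - α) with hB
  have hker : ∀ t : ℝ, ‖rieszKernel y ((κ - α : ℝ) + t * I)‖ ≤ B * (1 + t ^ 2)⁻¹ := fun t =>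
    norm_rieszKernel_le hy (lt_min hr one_pos) (min_le_right _ _)
      ((min_le_left _ _).trans (le_abs_self _)) (by linarith) t
  let F : Nat.Primes × ℕ → ℝ → ℂ :=
    fun x t => logTerm c x (κ + t * I) * rieszKernel y ((κ - α : ℝ) + t * I)
  have hF : ∀ x t, ‖F x t‖ ≤ m * (primePow x : ℝ) ^ (-κ) * (B * (1 + t ^ 2)⁻¹) := fun x t => by
    rw [norm_mul]
    have := norm_logTerm_le hc x (κ + t * I)
    simp only [add_re, ofReal_re, mul_re, I_re, mul_zero, ofReal_im, I_im, mul_one, sub_self,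
      add_zero] at this
    exact mul_le_mul this (hker t) (norm_nonneg _) (by positivity)
  have hFi : ∀ x, Integrable (F x) := fun x => by
    refine Integrable.mono' ((integrable_inv_one_add_sq.const_mul B).const_mul
      (m * (primePow x : ℝ) ^ (-κ))) (Continuous.aestronglyMeasurable ?_)
      (Eventually.of_forall (hF x))
    have hx : (primePow x : ℂ) ≠ 0 := by exact_mod_cast (primePow_pos x).ne'
    refine Continuous.mul ?_ (continuous_rieszKernel_line hy hr.ne' (by linarith))
    exact continuous_const.mul (Continuous.const_cpow (by fun_prop) (Or.inl hx))
  have hFs : Summable fun x => ∫ t, ‖F x t‖ := by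
    refine Summable.of_nonneg_of_le (fun x => integral_nonneg fun t => norm_nonneg _) (fun x => ?_)
      ((summable_primePow_rpow_neg hκ).mul_left (m * (B * Real.pi)))
    calc ∫ t, ‖F x t‖ ≤ ∫ t : ℝ, m * (primePow x : ℝ) ^ (-κ) * (B * (1 + t ^ 2)⁻¹) :=
          integral_mono (hFi x).norm ((integrable_inv_one_add_sq.const_mul B).const_mul _) (hF x)
      _ = m * (B * Real.pi) * (primePow x : ℝ) ^ (-κ) := by
          rw [integral_const_mul, integral_const_mul, integral_univ_inv_one_add_sq]; ring
  have hsum := hasSum_integral_of_summable_integral_norm hFi hFs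
  convert! hsum using 1
  · funext x
    have hx : (0 : ℝ) < primePow x := by exact_mod_cast primePow_pos x
    have hFx : ∀ t : ℝ, F x t
        = logTerm c x α * rieszKernel (y / primePow x) ((κ - α : ℝ) + t * I) := fun t => by
      have := mul_rieszKernel_eq hy hx (α : ℂ) (κ + t * I)
      simp only [F, logTerm]
      rw [show ((κ - α : ℝ) : ℂ) + t * I = (κ : ℂ) + t * I - α by push_cast; ring, mul_assoc,
        mul_assoc]
      exact congrArg _ (by exact_mod_cast this)
    simp only [hFx]
    rw [integral_const_mul, integral_rieszKernel_line (by positivity) hr, one_div_div]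
    ring
  · refine integral_congr_ae (Eventually.of_forall fun t => ?_)
    simp only [F, logSeries, tsum_mul_right]

/-! ### Moving the line of integration -/

lemma pi_div_two_sub_arctan_le {T : ℝ} (hT : 0 < T) : Real.pi / 2 - Real.arctan T ≤ 1 / T := by
  rw [← Real.arctan_inv_of_pos hT, one_div]
  have h := Real.le_tan (Real.arctan_nonneg.2 (inv_pos.2 hT).le) (Real.arctan_lt_pi_div_two _)
  rwa [Real.tan_arctan] at h

/-- The part of an integral over `ℝ` outside `[-T, T]`, for an integrand that decays
like `t⁻²`. -/
lemma norm_integral_sub_intervalIntegral_le {H : ℝ → ℂ} (hH : Integrable H) {T K : ℝ} (hT : 1 ≤ T)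
    (hK : 0 ≤ K) (hb : ∀ t, T ≤ |t| → ‖H t‖ ≤ K * (t ^ 2)⁻¹) :
    ‖(∫ t, H t) - ∫ t in (-T)..T, H t‖ ≤ 4 * K / T := by
  have hT0 : 0 < T := by linarith
  have hdec : (∫ t, H t) - ∫ t in (-T)..T, H t = (∫ t in Iic (-T), H t) + ∫ t in Ioi T, H t := by
    rw [← intervalIntegral.integral_Iic_sub_Iic hH.integrableOn hH.integrableOn,
      ← intervalIntegral.integral_Iic_add_Ioi (b := T) hH.integrableOn hH.integrableOn]
    ring
  have hb' : ∀ t, T ≤ |t| → ‖H t‖ ≤ 2 * K * (1 + t ^ 2)⁻¹ := fun t ht => by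
    refine (hb t ht).trans ?_
    have h1 : 1 ≤ t ^ 2 := by rw [← sq_abs]; nlinarith
    have h2 : (t ^ 2)⁻¹ ≤ 2 * (1 + t ^ 2)⁻¹ := by
      rw [← div_eq_mul_inv, inv_eq_one_div, div_le_div_iff₀ (by linarith) (by positivity)]
      linarith
    nlinarith
  have hi := integrable_inv_one_add_sq.const_mul (2 * K)
  have h1 : ‖∫ t in Iic (-T), H t‖ ≤ 2 * K * (1 / T) := by
    calc ‖∫ t in Iic (-T), H t‖ ≤ ∫ t in Iic (-T), 2 * K * (1 + t ^ 2)⁻¹ := by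
          refine norm_integral_le_of_norm_le hi.integrableOn ?_
          filter_upwards [ae_restrict_mem measurableSet_Iic] with t ht
          exact hb' t (by rw [le_abs]; right; linarith [mem_Iic.1 ht])
      _ = 2 * K * (Real.pi / 2 - Real.arctan T) := by
          rw [integral_const_mul, integral_Iic_inv_one_add_sq, Real.arctan_neg]; ring
      _ ≤ _ := by gcongr; exact pi_div_two_sub_arctan_le hT0
  have h2 : ‖∫ t in Ioi T, H t‖ ≤ 2 * K * (1 / T) := by
    calc ‖∫ t in Ioi T, H t‖ ≤ ∫ t in Ioi T, 2 * K * (1 + t ^ 2)⁻¹ := by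
          refine norm_integral_le_of_norm_le hi.integrableOn ?_
          filter_upwards [ae_restrict_mem measurableSet_Ioi] with t ht
          exact hb' t (by rw [le_abs]; left; linarith [mem_Ioi.1 ht])
      _ = 2 * K * (Real.pi / 2 - Real.arctan T) := by
          rw [integral_const_mul, integral_Ioi_inv_one_add_sq]
      _ ≤ _ := by gcongr; exact pi_div_two_sub_arctan_le hT0
  rw [hdec]
  refine (norm_add_le _ _).trans ((add_le_add h1 h2).trans (le_of_eq ?_))
  ring

/-- Comparison of the full Riesz-Perron integral of `F` on `σ = κ` with the value `F α`: the
difference `F - F α` is integrated instead of `F`, so that no residue occurs, and the segment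
`|t| ≤ T` is moved to `σ = β`. -/
lemma norm_integral_rieszKernel_sub_le {F : ℂ → ℂ} {U : Set ℂ} (hU : IsOpen U)
    (hF : DifferentiableOn ℂ F U) {α β κ T y A B : ℝ} (hy : 1 ≤ y) (hβα : β < α) (hακ : α < κ)
    (hβ : α - 1 / 2 ≤ β) (hT : 1 ≤ T)
    (hsub : ∀ z : ℂ, β ≤ z.re → z.re ≤ κ → |z.im| ≤ T → z ∈ U)
    (hA : ∀ z : ℂ, β ≤ z.re → z.re ≤ κ → |z.im| ≤ T → ‖F z‖ ≤ A)
    (hcont : Continuous fun t : ℝ => F (κ + t * I))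
    (hB : ∀ t : ℝ, ‖F (κ + t * I)‖ ≤ B) :
    ‖(∫ t : ℝ, F (κ + t * I) * rieszKernel y ((κ - α : ℝ) + t * I))
        - 2 * Real.pi * ((1 - 1 / y : ℝ) : ℂ) * F α‖
      ≤ 4 * (A + B) * y ^ (κ - α) / T + 4 * A * y ^ (κ - α) * (κ - β) / T ^ 2
        + 4 * Real.pi * A / (α - β) * y ^ (β - α) := by
  have hy0 : 0 < y := by linarith
  have hr : 0 < κ - α := by linarith
  have hT0 : 0 < T := by linarith
  have hαU : (α : ℂ) ∈ U :=
    hsub _ (by simpa using hβα.le) (by simpa using hακ.le) (by simpa using hT0.le)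
  have hFα : ‖F α‖ ≤ A :=
    hA _ (by simpa using hβα.le) (by simpa using hακ.le) (by simpa using hT0.le)
  have hA0 : 0 ≤ A := (norm_nonneg _).trans hFα
  have hB0 : 0 ≤ B := (norm_nonneg _).trans (hB 0)
  have hdiff : ∀ z : ℂ, β ≤ z.re → z.re ≤ κ → |z.im| ≤ T → ‖F z - F α‖ ≤ 2 * A :=
    fun z h1 h2 h3 => (norm_sub_le _ _).trans (by linarith [hA z h1 h2 h3])
  have hdiffκ : ∀ t : ℝ, ‖F (κ + t * I) - F α‖ ≤ A + B := fun t =>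
    (norm_sub_le _ _).trans (by linarith [hB t])
  have hki := integrable_rieszKernel_line hy0 hr
  have hkc := continuous_rieszKernel_line hy0 hr.ne' (by linarith : -1 / 2 ≤ κ - α)
  let H : ℝ → ℂ := fun t => (F (κ + t * I) - F α) * rieszKernel y ((κ - α : ℝ) + t * I)
  have hFi : Integrable fun t : ℝ => F (κ + t * I) * rieszKernel y ((κ - α : ℝ) + t * I) :=
    hki.bdd_mul hcont.aestronglyMeasurable (Eventually.of_forall hB)
  have hH : Integrable H :=
    hki.bdd_mul (hcont.sub continuous_const).aestronglyMeasurable (Eventually.of_forall hdiffκ)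
  have hHint : (∫ t : ℝ, F (κ + t * I) * rieszKernel y ((κ - α : ℝ) + t * I))
      - 2 * Real.pi * ((1 - 1 / y : ℝ) : ℂ) * F α = ∫ t, H t := by
    have hmax : max (1 - 1 / y) 0 = 1 - 1 / y :=
      max_eq_left (sub_nonneg.2 ((div_le_one hy0).2 hy))
    simp only [H, sub_mul]
    rw [integral_sub hFi (hki.const_mul _), integral_const_mul, integral_rieszKernel_line hy0 hr,
      hmax]
    ring
  have htail := norm_integral_sub_intervalIntegral_le hH hT
    (by positivity : 0 ≤ (A + B) * y ^ (κ - α)) fun t ht => by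
      have ht0 : t ≠ 0 := by rintro rfl; simp at ht; linarith
      rw [norm_mul, mul_assoc]
      exact mul_le_mul (hdiffκ t) (norm_rieszKernel_le_inv_sq hy0 ht0) (norm_nonneg _)
        (by linarith)
  -- the removable singularity at `α` is filled in by `dslope`
  let G : ℂ → ℂ := fun z => dslope F α z * ((y : ℂ) ^ (z - α) / (z - α + 1))
  have hG : ∀ r t : ℝ, (r : ℂ) + t * I ≠ α →
      G (r + t * I) = (F (r + t * I) - F α) * rieszKernel y ((r - α : ℝ) + t * I) :=
    fun r t h => by
      have e : ((r - α : ℝ) : ℂ) + t * I = (r : ℂ) + t * I - α := by push_cast; ring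
      have h' : (r : ℂ) + t * I - α ≠ 0 := sub_ne_zero.2 h
      simp only [G]
      rw [dslope_of_ne _ h, slope, e, rieszKernel, vsub_eq_sub, smul_eq_mul, mul_comm _⁻¹,
        mul_assoc, inv_mul_eq_div, div_div, mul_comm (_ + 1)]
  have hGd : DifferentiableOn ℂ G (uIcc β κ ×ℂ uIcc (-T) T) := by
    have hR : ∀ z ∈ uIcc β κ ×ℂ uIcc (-T) T, β ≤ z.re ∧ z.re ≤ κ ∧ |z.im| ≤ T := fun z hz => by
      rw [uIcc_of_le (by linarith), uIcc_of_le (by linarith)] at hz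
      exact ⟨hz.1.1, hz.1.2, abs_le.2 hz.2⟩
    have hy' : (y : ℂ) ≠ 0 := by exact_mod_cast hy0.ne'
    refine (((differentiableOn_dslope (hU.mem_nhds hαU)).2 hF).mono fun z hz =>
      hsub z (hR z hz).1 (hR z hz).2.1 (hR z hz).2.2).mul fun z hz => ?_
    refine DifferentiableAt.differentiableWithinAt (DifferentiableAt.div ?_ (by fun_prop) ?_)
    · exact DifferentiableAt.const_cpow (by fun_prop) (Or.inl hy')
    · intro h
      have := congrArg Complex.re h
      simp at this
      linarith [(hR z hz).1]
  have hrect := Complex.integral_boundary_rect_eq_zero_of_differentiableOn G ⟨β, -T⟩ ⟨κ, T⟩ hGd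
  simp only at hrect
  have hright : ∫ t in (-T)..T, G (κ + t * I) = ∫ t in (-T)..T, H t := by
    refine intervalIntegral.integral_congr fun t _ => ?_
    refine hG κ t fun h => ?_
    have := congrArg Complex.re h
    simp at this
    linarith
  have hhor : ∀ τ : ℝ, |τ| = T → ‖∫ x in β..κ, G (x + τ * I)‖
      ≤ 2 * A * (y ^ (κ - α) * (T ^ 2)⁻¹) * |κ - β| := fun τ hτ => by
    refine intervalIntegral.norm_integral_le_of_norm_le_const fun x hx => ?_
    rw [uIoc_of_le (by linarith)] at hx
    have hτ0 : τ ≠ 0 := by rintro rfl; simp at hτ; linarith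
    rw [hG x τ fun h => hτ0 (by simpa using congrArg Complex.im h), norm_mul]
    have h1 := hdiff (x + τ * I) (by simpa using hx.1.le) (by simpa using hx.2)
      (by simpa using hτ.le)
    have h2 : ‖rieszKernel y ((x - α : ℝ) + τ * I)‖ ≤ y ^ (κ - α) * (T ^ 2)⁻¹ := by
      refine (norm_rieszKernel_le_inv_sq hy0 hτ0).trans ?_
      rw [← hτ, sq_abs]
      gcongr
      exact hx.2
    exact mul_le_mul h1 h2 (norm_nonneg _) (by linarith)
  have hleft : ‖∫ t in (-T)..T, G (β + t * I)‖
      ≤ 4 * Real.pi * A / (α - β) * y ^ (β - α) := by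
    have hpt : ∀ t : ℝ, ‖G (β + t * I)‖ ≤ 2 * A * (2 / (α - β) * y ^ (β - α)) * (1 + t ^ 2)⁻¹ ∨
        T < |t| := fun t => by
      rcases lt_or_ge T |t| with h | h
      · exact Or.inr h
      left
      rw [hG β t fun h => by
        have := congrArg Complex.re h
        simp at this; linarith, norm_mul, mul_assoc]
      refine mul_le_mul (hdiff _ (by simp) (by simpa using by linarith) (by simpa using h))
        (norm_rieszKernel_le hy0 (by linarith) (by linarith) ?_ (by linarith) t) (norm_nonneg _)
        (by linarith)
      rw [abs_of_neg (by linarith)]; linarith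
    calc ‖∫ t in (-T)..T, G (β + t * I)‖
        ≤ ∫ t in (-T)..T, 2 * A * (2 / (α - β) * y ^ (β - α)) * (1 + t ^ 2)⁻¹ := by
          refine intervalIntegral.norm_integral_le_of_norm_le (by linarith)
            (Eventually.of_forall fun t ht => ?_)
            (integrable_inv_one_add_sq.const_mul _).intervalIntegrable
          exact (hpt t).resolve_right (not_lt.2 (abs_le.2 ⟨ht.1.le, ht.2⟩))
      _ = 2 * A * (2 / (α - β) * y ^ (β - α)) * (2 * Real.arctan T) := by
          rw [intervalIntegral.integral_const_mul, integral_inv_one_add_sq, Real.arctan_neg]; ring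
      _ ≤ 2 * A * (2 / (α - β) * y ^ (β - α)) * Real.pi := by
          have : 0 < α - β := by linarith
          gcongr
          linarith [Real.arctan_lt_pi_div_two T]
      _ = _ := by ring
  have hmid : ‖∫ t in (-T)..T, H t‖ ≤ 4 * A * y ^ (κ - α) * (κ - β) / T ^ 2
      + 4 * Real.pi * A / (α - β) * y ^ (β - α) := by
    rw [hright] at hrect
    have e : I * (∫ t in (-T)..T, H t) = (∫ x in β..κ, G (x + T * I))
        - (∫ x in β..κ, G (x + (-T : ℝ) * I)) + I * ∫ t in (-T)..T, G (β + t * I) := by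
      simp only [smul_eq_mul] at hrect
      linear_combination hrect
    have en : ‖∫ t in (-T)..T, H t‖ = ‖I * ∫ t in (-T)..T, H t‖ := by
      rw [norm_mul, norm_I, one_mul]
    rw [en, e]
    refine (norm_add_le _ _).trans (add_le_add ?_ ?_)
    · refine (norm_sub_le _ _).trans ((add_le_add (hhor T (abs_of_pos hT0))
        (hhor (-T) (by rw [abs_neg, abs_of_pos hT0]))).trans (le_of_eq ?_))
      rw [abs_of_pos (by linarith)]
      field_simp
      ring
    · rwa [norm_mul, norm_I, one_mul]
  rw [hHint]
  have := norm_le_norm_sub_add (∫ t, H t) (∫ t in (-T)..T, H t)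
  rw [← mul_assoc] at htail
  linarith

/-! ### Removing the Riesz weight -/

/-- The constant by which the proper prime powers enter the cost of removing the Riesz weight. The
exponent is `7/8 - 1/4`, where `α ≥ 7/8` and `1/4` is spent on the decay in `y`. -/
def properPowerSum : ℝ := ∑' x : Nat.Primes × ℕ, (primePow (x.1, x.2 + 1) : ℝ) ^ (-(5 / 8) : ℝ)

lemma properPowerSum_nonneg : 0 ≤ properPowerSum := tsum_nonneg fun _ => by positivity

lemma primePow_ofReal_cpow_neg (x : Nat.Primes × ℕ) (α : ℝ) :
    (primePow x : ℂ) ^ (-(α : ℂ)) = (((primePow x : ℝ) ^ (-α) : ℝ) : ℂ) := by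
  rw [ofReal_cpow (by positivity)]; push_cast; rfl

lemma summable_logTerm_succ (hc : ∀ (j : Fin m) (p : ℕ), p.Prime → ‖c j p‖ ≤ 1) {α : ℝ}
    (hα : 1 / 2 < α) : Summable fun x : Nat.Primes × ℕ => logTerm c (x.1, x.2 + 1) α :=
  Summable.of_norm_bounded ((summable_primePow_succ_rpow_neg hα).mul_left (m : ℝ)) fun x => by
    simpa using norm_logTerm_le hc (x.1, x.2 + 1) α

lemma C_eq_tsum (hc : ∀ (j : Fin m) (p : ℕ), p.Prime → ‖c j p‖ ≤ 1) {α : ℝ} (hα : 1 / 2 < α) :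
    C c α = ∑' x : Nat.Primes × ℕ, logTerm c (x.1, x.2 + 1) α := by
  rw [(summable_logTerm_succ hc hα).tsum_prod, C]
  refine tsum_congr fun p => tsum_congr fun k => ?_
  rw [logTerm, primePow_ofReal_cpow_neg, Real.rpow_neg (by positivity), primePow, Nat.cast_pow,
    ← Real.rpow_natCast, ← Real.rpow_mul (by positivity), ofReal_inv, ← div_eq_mul_inv, div_div]

lemma tsum_primes_eq_primeSum {y α : ℝ} (hy : 0 < y) :
    ∑' p : Nat.Primes, logTerm c (p, 0) α * ((max (1 - primePow (p, 0) / y) 0 : ℝ) : ℂ)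
      = ∑ p ∈ (Finset.Icc 1 ⌊y⌋₊).filter Nat.Prime,
          d c p 1 / ((((p : ℝ) ^ α : ℝ)) : ℂ) * ((1 - p / y : ℝ) : ℂ) := by
  let g : ℕ → ℂ := fun p => d c p 1 / ((((p : ℝ) ^ α : ℝ)) : ℂ) * ((max (1 - p / y) 0 : ℝ) : ℂ)
  have h1 : ∀ p : Nat.Primes,
      logTerm c (p, 0) α * ((max (1 - primePow (p, 0) / y) 0 : ℝ) : ℂ) = g p := fun p => by
    rw [logTerm, primePow_ofReal_cpow_neg, Real.rpow_neg (by positivity)]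
    simp only [g, primePow, zero_add, pow_one, Nat.cast_one, div_one, ofReal_inv, ← div_eq_mul_inv]
  simp only [h1]
  rw [show ∑' p : Nat.Primes, g p = ∑' n, {p : ℕ | p.Prime}.indicator g n from
    tsum_subtype {p : ℕ | p.Prime} g, tsum_eq_sum (s := (Finset.Icc 1 ⌊y⌋₊).filter Nat.Prime)]
  · refine Finset.sum_congr rfl fun p hp => ?_
    rw [Finset.mem_filter, Finset.mem_Icc] at hp
    have hpy : (p : ℝ) ≤ y := (Nat.le_floor_iff hy.le).1 hp.1.2
    rw [indicator_of_mem (by exact hp.2)]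
    simp only [g]
    rw [max_eq_left (sub_nonneg.2 ((div_le_one hy).2 hpy))]
  · intro p hp
    by_cases hpp : p.Prime
    · rw [indicator_of_mem (by exact hpp)]
      have hpy : y < p := by
        by_contra! h
        exact hp (Finset.mem_filter.2 ⟨Finset.mem_Icc.2 ⟨hpp.one_le, Nat.le_floor h⟩, hpp⟩)
      simp only [g]
      rw [max_eq_right (sub_nonpos.2 ((one_le_div hy).2 hpy.le)), ofReal_zero, mul_zero]
    · exact indicator_of_notMem hpp _

/-- Chebyshev's bound controls the effect of the weight on the primes. -/
lemma norm_weighted_sub_primeSum_le (hc : ∀ (j : Fin m) (p : ℕ), p.Prime → ‖c j p‖ ≤ 1)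
    {y α : ℝ} (hy : 1 < y) (hα : α ≤ 1) :
    ‖(∑ p ∈ (Finset.Icc 1 ⌊y⌋₊).filter Nat.Prime,
          d c p 1 / ((((p : ℝ) ^ α : ℝ)) : ℂ) * ((1 - p / y : ℝ) : ℂ)) - primeSum c y α‖
      ≤ 8 * m * y ^ (1 - α) / Real.log y := by
  have hy0 : 0 < y := by linarith
  rw [primeSum, ← Finset.sum_sub_distrib]
  have hterm : ∀ p ∈ (Finset.Icc 1 ⌊y⌋₊).filter Nat.Prime,
      ‖d c p 1 / ((((p : ℝ) ^ α : ℝ)) : ℂ) * ((1 - p / y : ℝ) : ℂ)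
        - d c p 1 / ((((p : ℝ) ^ α : ℝ)) : ℂ)‖ ≤ m * y ^ (1 - α) / y := fun p hp => by
    rw [Finset.mem_filter, Finset.mem_Icc] at hp
    have hpy : (p : ℝ) ≤ y := (Nat.le_floor_iff hy0.le).1 hp.1.2
    have hp0 : (0 : ℝ) < p := by exact_mod_cast hp.2.pos
    have e : d c p 1 / ((((p : ℝ) ^ α : ℝ)) : ℂ) * ((1 - p / y : ℝ) : ℂ)
        - d c p 1 / ((((p : ℝ) ^ α : ℝ)) : ℂ) = -(d c p 1 * (((p : ℝ) ^ (1 - α) / y : ℝ) : ℂ)) := by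
      rw [Real.rpow_sub hp0, Real.rpow_one]
      push_cast
      ring
    rw [e, norm_neg, norm_mul, norm_real, Real.norm_of_nonneg (by positivity), mul_div_assoc]
    gcongr
    exact norm_d_le hc hp.2 1
  refine (norm_sum_le_of_le _ hterm).trans ?_
  rw [Finset.sum_const, nsmul_eq_mul]
  have hcard : ((Finset.Icc 1 ⌊y⌋₊).filter Nat.Prime).card ≤ Nat.primeCounting ⌊y⌋₊ := by
    rw [Nat.primeCounting, Nat.primeCounting', Nat.count_eq_card_filter_range]
    refine Finset.card_le_card fun p hp => ?_
    simp only [Finset.mem_filter, Finset.mem_Icc, Finset.mem_range] at hp ⊢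
    exact ⟨by omega, hp.2⟩
  calc (((Finset.Icc 1 ⌊y⌋₊).filter Nat.Prime).card : ℝ) * (m * y ^ (1 - α) / y)
      ≤ (8 * y / Real.log y) * (m * y ^ (1 - α) / y) := by
        gcongr
        exact (Nat.cast_le.2 hcard).trans (primeCounting_floor_le hy)
    _ = 8 * m * y ^ (1 - α) / Real.log y := by field_simp

lemma one_sub_weight_le {q y : ℝ} (hq : 0 < q) (hy : 0 < y) :
    |max (1 - q / y) 0 - 1| ≤ (q / y) ^ (1 / 4 : ℝ) := by
  have hx : 0 < q / y := by positivity
  rcases le_or_gt (q / y) 1 with h | h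
  · rw [max_eq_left (by linarith), sub_sub_cancel_left, abs_neg, abs_of_pos hx]
    simpa using Real.rpow_le_rpow_of_exponent_ge hx h (by norm_num : (1 / 4 : ℝ) ≤ 1)
  · rw [max_eq_right (by linarith), zero_sub, abs_neg, abs_one]
    exact Real.one_le_rpow h.le (by norm_num)

/-- The weight differs from `1` by at most `(q / y) ^ (1/4)`, which saves `y ^ (-1/4)` and leaves
a convergent sum over proper prime powers. -/
lemma norm_weighted_sub_C_le (hc : ∀ (j : Fin m) (p : ℕ), p.Prime → ‖c j p‖ ≤ 1)
    {y α : ℝ} (hy : 0 < y) (hα : 7 / 8 ≤ α)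
    (hs : Summable fun x : Nat.Primes × ℕ =>
      logTerm c (x.1, x.2 + 1) α * ((max (1 - primePow (x.1, x.2 + 1) / y) 0 : ℝ) : ℂ)) :
    ‖(∑' x : Nat.Primes × ℕ,
        logTerm c (x.1, x.2 + 1) α * ((max (1 - primePow (x.1, x.2 + 1) / y) 0 : ℝ) : ℂ)) - C c α‖
      ≤ m * properPowerSum * y ^ (-(1 / 4) : ℝ) := by
  rw [C_eq_tsum hc (by linarith),
    ← hs.tsum_sub (summable_logTerm_succ hc (by linarith : 1 / 2 < α))]
  have hS := (summable_primePow_succ_rpow_neg (by norm_num : (1 / 2 : ℝ) < 5 / 8))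
  refine (tsum_of_norm_bounded (hS.mul_left (m * y ^ (-(1 / 4) : ℝ))).hasSum fun x => ?_).trans ?_
  · set q : ℝ := (primePow (x.1, x.2 + 1) : ℝ) with hq
    have hq1 : 1 ≤ q := one_le_primePow _
    have hq0 : 0 < q := by linarith
    have h1 : ‖logTerm c (x.1, x.2 + 1) α‖ ≤ m * q ^ (-α) := by
      simpa using norm_logTerm_le hc (x.1, x.2 + 1) α
    have h2 : ‖((max (1 - q / y) 0 : ℝ) : ℂ) - 1‖ ≤ (q / y) ^ (1 / 4 : ℝ) := by
      have := one_sub_weight_le hq0 hy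
      rw [← Real.norm_eq_abs, ← norm_real] at this
      simpa using this
    rw [show ∀ u v : ℂ, u * v - u = u * (v - 1) from fun u v => by ring, norm_mul]
    calc _ ≤ m * q ^ (-α) * (q / y) ^ (1 / 4 : ℝ) :=
          mul_le_mul h1 h2 (norm_nonneg _) (by positivity)
      _ = m * y ^ (-(1 / 4) : ℝ) * q ^ (1 / 4 - α) := by
          rw [Real.div_rpow hq0.le hy.le, Real.rpow_neg hy.le, sub_eq_add_neg, Real.rpow_add hq0]
          ring
      _ ≤ m * y ^ (-(1 / 4) : ℝ) * q ^ (-(5 / 8) : ℝ) := by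
          gcongr
          linarith
  · rw [tsum_mul_left, ← properPowerSum]
    exact le_of_eq (by ring)

/-- The Riesz mean of the series of `log L` at `α` is `∑_{p ≤ y} d_p(1) p^{-α} + C(α)`, up to a
small error. -/
lemma norm_riesz_sub_le (hc : ∀ (j : Fin m) (p : ℕ), p.Prime → ‖c j p‖ ≤ 1)
    {y α : ℝ} (hy : 1 < y) (hα : 7 / 8 ≤ α) (hα1 : α ≤ 1)
    (hs : Summable fun x => logTerm c x α * ((max (1 - primePow x / y) 0 : ℝ) : ℂ)) :
    ‖(∑' x, logTerm c x α * ((max (1 - primePow x / y) 0 : ℝ) : ℂ))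
        - (primeSum c y α + C c α)‖
      ≤ 8 * m * y ^ (1 - α) / Real.log y + m * properPowerSum * y ^ (-(1 / 4) : ℝ) := by
  have hy0 : 0 < y := by linarith
  have hs1 := hs.comp_injective (i := fun x : Nat.Primes × ℕ => (x.1, x.2 + 1))
    fun u v h => by simpa [Prod.ext_iff] using h
  have hs0 := hs.comp_injective (i := fun p : Nat.Primes => (p, 0))
    fun u v h => by simpa using h
  have hsplit : ∑' x, logTerm c x α * ((max (1 - primePow x / y) 0 : ℝ) : ℂ)
      = (∑' p : Nat.Primes, logTerm c (p, 0) α * ((max (1 - primePow (p, 0) / y) 0 : ℝ) : ℂ))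
        + ∑' x : Nat.Primes × ℕ,
          logTerm c (x.1, x.2 + 1) α * ((max (1 - primePow (x.1, x.2 + 1) / y) 0 : ℝ) : ℂ) := by
    rw [hs.tsum_prod, tsum_congr fun p => (hs.prod_factor p).tsum_eq_zero_add]
    have h1 := hs1.tsum_prod
    have h2 := hs0.tsum_add hs1.prod
    simp only [Function.comp_apply] at h1 h2
    rw [h1, h2]
  rw [hsplit, tsum_primes_eq_primeSum hy0, add_sub_add_comm]
  exact (norm_add_le _ _).trans (add_le_add (norm_weighted_sub_primeSum_le hc hy hα1)
    (norm_weighted_sub_C_le hc hy0 hα hs1))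

/-! ### The size of `log L` in the zero-free region -/

lemma log_natCast_ge {N : ℕ} (hN : 16 ≤ N) : (2.75 : ℝ) ≤ Real.log N := by
  have h1 : Real.log 16 ≤ Real.log N :=
    Real.log_le_log (by norm_num) (by exact_mod_cast hN)
  rw [show (16 : ℝ) = 2 ^ 4 by norm_num, Real.log_pow] at h1
  have := Real.log_two_gt_d9
  push_cast at h1
  linarith

lemma one_le_log_log {N : ℕ} (hN : 16 ≤ N) : 1 ≤ Real.log (Real.log N) := by
  have h := log_natCast_ge hN
  rw [Real.le_log_iff_exp_le (by linarith)]
  linarith [Real.exp_one_lt_d9]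

/-- The open half strip in which every point of `region δ N` has a neighbourhood inside it. -/
def openHalfStrip (δ : ℝ) (N : ℕ) : Set ℂ :=
  {s : ℂ | 1 - δ / 7 < s.re} ∩ {s : ℂ | |s.im| < 2 * Real.log N ^ 3}

lemma isOpen_openHalfStrip (δ : ℝ) (N : ℕ) : IsOpen (openHalfStrip δ N) :=
  (isOpen_lt continuous_const Complex.continuous_re).inter
    (isOpen_lt Complex.continuous_im.abs continuous_const)

lemma openHalfStrip_subset (δ : ℝ) (N : ℕ) : openHalfStrip δ N ⊆ region δ N := fun _ hs => by
  rw [region_eq_union]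
  exact Or.inr ⟨(mem_ofPred_eq.mp hs.1 : _ < _).le, (mem_ofPred_eq.mp hs.2 : _ < _).le⟩

/-- The factor of `log N` in the upper bound for `log |L|` that the convexity bound gives. -/
def convexityConst (γ₁ γ₂ C₀ : ℝ) : ℝ := |Real.log C₀| + γ₁ + 4 * γ₂

lemma re_log_le {γ₁ γ₂ C₀ σL δ : ℝ} (hγ₂ : 0 < γ₂) (hC₀ : 0 < C₀) {N : ℕ} (hN : 16 ≤ N)
    {L logL : ℂ → ℂ} (hV : HasConvexityBound γ₁ γ₂ C₀ σL N L) (hlog : IsLogOf c δ N L logL)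
    {s : ℂ} (hs : s ∈ region δ N) (h1 : σL < s.re) (h2 : s.re < 4)
    (h3 : |s.im| ≤ 2 * Real.log N ^ 3) :
    (logL s).re ≤ convexityConst γ₁ γ₂ C₀ * Real.log N := by
  have hl := log_natCast_ge hN
  have hN' : (16 : ℝ) ≤ N := by exact_mod_cast hN
  have hlN : Real.log N ≤ N := Real.log_le_self (by linarith)
  have h5 : 1 + |s.im| ≤ (N : ℝ) ^ (4 : ℝ) := by
    have : Real.log N ^ 3 ≤ (N : ℝ) ^ 3 := pow_le_pow_left₀ (by linarith) hlN 3
    have h6 : (1 : ℝ) ≤ (N : ℝ) ^ 3 := one_le_pow₀ (by linarith)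
    have h7 : (N : ℝ) ^ (4 : ℝ) = N * (N : ℝ) ^ 3 := by
      rw [show (4 : ℝ) = ((4 : ℕ) : ℝ) by norm_num, Real.rpow_natCast]; ring
    rw [h7]
    nlinarith
  have h6 : Real.exp (logL s).re ≤ Real.exp (Real.log C₀ + (γ₁ + 4 * γ₂) * Real.log N) := by
    rw [← Complex.norm_exp, hlog.exp_eq s hs]
    refine (hV s h1 h2).trans ?_
    have h7 : (1 + |s.im|) ^ γ₂ ≤ (N : ℝ) ^ (4 * γ₂) := by
      rw [Real.rpow_mul (by linarith)]
      exact Real.rpow_le_rpow (by positivity) h5 hγ₂.le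
    calc C₀ * (N : ℝ) ^ γ₁ * (1 + |s.im|) ^ γ₂
        ≤ C₀ * (N : ℝ) ^ γ₁ * (N : ℝ) ^ (4 * γ₂) := by gcongr
      _ = _ := by
        rw [Real.exp_add, Real.exp_log hC₀, mul_assoc, ← Real.rpow_add (by linarith),
          Real.rpow_def_of_pos (by linarith), mul_comm (Real.log N)]
  have h8 := Real.exp_le_exp.1 h6
  have h9 : Real.log C₀ ≤ |Real.log C₀| * Real.log N := by
    nlinarith [le_abs_self (Real.log C₀), abs_nonneg (Real.log C₀)]
  rw [convexityConst]
  linarith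

/-- The implied constant in `log L ≪ (log N) / δ`. -/
def logConst (m : ℕ) (γ₁ γ₂ C₀ : ℝ) : ℝ := 84 * convexityConst γ₁ γ₂ C₀ + 168 * m

lemma norm_log_le {γ₁ γ₂ C₀ σL δ : ℝ} (hγ₁ : 0 < γ₁) (hγ₂ : 0 < γ₂) (hC₀ : 0 < C₀) {N : ℕ}
    (hN : 16 ≤ N) {L logL : ℂ → ℂ} (hE : HasEulerProduct c L) (hC : HasContinuation σL L)
    (hZ : IsZeroFree σL δ N L) (hV : HasConvexityBound γ₁ γ₂ C₀ σL N L)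
    (hlog : IsLogOf c δ N L logL) {z : ℂ} (h1 : 1 - 3 * δ / 28 ≤ z.re) (h2 : z.re ≤ 2)
    (h3 : |z.im| ≤ Real.log N ^ 3) :
    ‖logL z‖ ≤ logConst m γ₁ γ₂ C₀ * Real.log N / δ := by
  have hl := log_natCast_ge hN
  have hδ := hZ.pos
  have hσ := hC.half_le
  have hδσ := hZ.lt
  have hl3 : 8 ≤ Real.log N ^ 3 := by
    have : (2 : ℝ) ^ 3 ≤ Real.log N ^ 3 := pow_le_pow_left₀ (by norm_num) (by linarith) 3
    linarith
  have hc1 : 0 < convexityConst γ₁ γ₂ C₀ := by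
    have := abs_nonneg (Real.log C₀)
    rw [convexityConst]; linarith
  set M := convexityConst γ₁ γ₂ C₀ * Real.log N with hM
  have hM0 : 0 < M := mul_pos hc1 (by linarith)
  -- the disc of radius `1 + δ/7` about `2 + i t`, `t = im z`, touches the line `σ = 1 - δ/7`
  set R := 1 + δ / 7 with hR
  set z₀ : ℂ := 2 + z.im * I with hz₀
  have hball : ∀ w ∈ Metric.ball (0 : ℂ) R, z₀ + w ∈ openHalfStrip δ N ∧ (z₀ + w).re < 4 :=
    fun w hw => by
      rw [mem_ball_zero_iff] at hw
      have hre := abs_le.1 (Complex.abs_re_le_norm w)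
      have him := (Complex.abs_im_le_norm w)
      have e1 : (z₀ + w).re = 2 + w.re := by simp [hz₀]
      have e2 : (z₀ + w).im = z.im + w.im := by simp [hz₀]
      refine ⟨⟨?_, ?_⟩, ?_⟩
      · simp only [mem_ofPred_eq, e1]; linarith
      · simp only [mem_ofPred_eq, e2]
        have := abs_add_le z.im w.im
        linarith
      · rw [e1]; linarith
  have hd : DifferentiableOn ℂ (fun w => logL (z₀ + w)) (Metric.ball 0 R) := by
    refine (hlog.holomorphic.mono (openHalfStrip_subset δ N)).comp
      (by fun_prop) fun w hw => (hball w hw).1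
  have hmaps : MapsTo (fun w => logL (z₀ + w)) (Metric.ball 0 R) {w | w.re ≤ M} := fun w hw => by
    obtain ⟨⟨ha, hb⟩, h4⟩ := hball w hw
    simp only [mem_ofPred_eq] at ha hb
    exact re_log_le hγ₂ hC₀ hN hV hlog (openHalfStrip_subset δ N ⟨ha, hb⟩) (by linarith) h4 hb.le
  have hnorm : ‖z - z₀‖ = 2 - z.re := by
    have : z - z₀ = ((z.re - 2 : ℝ) : ℂ) := by
      apply Complex.ext <;> simp [hz₀]
    rw [this, norm_real, Real.norm_eq_abs, abs_of_nonpos (by linarith)]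
    ring
  have hbc := Complex.borelCaratheodory hM0 hd hmaps (by positivity)
    (by rw [mem_ball_zero_iff, hnorm]; linarith : z - z₀ ∈ Metric.ball (0 : ℂ) R)
  simp only [add_sub_cancel, add_zero, hnorm] at hbc
  have h0 : ‖logL z₀‖ ≤ 2 * m := by
    have hre : z₀.re = 2 := by simp [hz₀]
    rw [hlog.eq_series z₀ (by rw [hre]; norm_num), ← logSeries_eq hE.norm_coeff_le
      (by rw [hre]; norm_num)]
    refine (norm_logSeries_le hE.norm_coeff_le (by rw [hre]; norm_num)).trans (le_of_eq ?_)
    rw [hre]; ring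
  refine hbc.trans ?_
  have hgap : δ / 28 ≤ R - (2 - z.re) := by rw [hR]; linarith
  have hgap0 : 0 < R - (2 - z.re) := by linarith
  rw [← add_div, div_le_div_iff₀ hgap0 hδ]
  have hn : 2 * M * (2 - z.re) + ‖logL z₀‖ * (R + (2 - z.re)) ≤ 3 * M + 6 * m := by
    have hRr : R + (2 - z.re) ≤ 3 := by linarith
    have := mul_le_mul h0 hRr (by linarith) (by positivity)
    nlinarith
  have hlm : (6 * m : ℝ) ≤ 6 * m * Real.log N :=
    le_mul_of_one_le_right (by positivity) (by linarith)
  calc (2 * M * (2 - z.re) + ‖logL z₀‖ * (R + (2 - z.re))) * δ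
      ≤ (3 * M + 6 * m * Real.log N) * δ :=
        mul_le_mul_of_nonneg_right (by linarith) hδ.le
    _ = logConst m γ₁ γ₂ C₀ * Real.log N * (δ / 28) := by rw [logConst, hM]; ring
    _ ≤ _ := by
        refine mul_le_mul_of_nonneg_left hgap (mul_nonneg ?_ (by linarith))
        rw [logConst]; positivity

/-! ### The estimate -/

lemma log_le_of_le_rpow {N : ℕ} (hN : 16 ≤ N) {y : ℝ} (hy0 : 0 < y)
    (hy : y ≤ (N : ℝ) ^ (2 * Real.pi / 5)) : Real.log y ≤ 2 * Real.log N := by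
  have hl := log_natCast_ge hN
  have hN0 : (0 : ℝ) < N := by positivity
  have h := Real.log_le_log hy0 hy
  rw [Real.log_rpow hN0] at h
  nlinarith [Real.pi_le_four]

lemma div_le_log_of_rpow_le {N : ℕ} (hN : 16 ≤ N) {δ y : ℝ} (hδ : 0 < δ)
    (hy : Real.log N ^ (14 / δ) ≤ y) : 14 / δ ≤ Real.log y := by
  have hl := log_natCast_ge hN
  have h := Real.log_le_log (Real.rpow_pos_of_pos (by linarith) _) hy
  rw [Real.log_rpow (by linarith)] at h
  have : 14 / δ * 1 ≤ 14 / δ * Real.log (Real.log N) :=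
    mul_le_mul_of_nonneg_left (one_le_log_log hN) (by positivity)
  linarith

lemma rpow_div_log {y : ℝ} (hy : 1 < y) (b : ℝ) : y ^ (b / Real.log y) = Real.exp b := by
  rw [Real.rpow_def_of_pos (by linarith), mul_div_cancel₀ _ (Real.log_pos hy).ne']

/-- The numerical evaluation of the errors in the shift of the line of integration, for
`T = (log N)^3`, `l = log N` and the bounds `A` and `B` for `log L` on the rectangle and on the
line `σ = κ`. -/
lemma shift_error_le {K₁ m l δ y a D α β κ A B : ℝ} (hK₁0 : 0 ≤ K₁) (hm : 0 ≤ m) (hl : 1 ≤ l)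
    (hδ : 0 < δ) (hδ2 : δ < 7 / 2) (hyone : 1 < y) (hyl : l ^ 4 ≤ y) (hD : D = Real.log y)
    (hD4 : 4 ≤ D) (hD2 : D ≤ 2 * l) (hδl : l / δ ≤ l ^ 2) (ha : 0 ≤ a) (haD : a / D < δ / 28)
    (hα : α = 1 - a / D) (hβ : β = 1 - 3 * δ / 28) (hκ : κ = 1 + 1 / D) (hA : A = K₁ * l / δ)
    (hB : B = m * (1 + D)) :
    4 * (A + B) * y ^ (κ - α) / l ^ 3 + 4 * A * y ^ (κ - α) * (κ - β) / (l ^ 3) ^ 2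
        + 4 * Real.pi * A / (α - β) * y ^ (β - α) + A / y
      ≤ (50 * K₁ + 72 * m) * (Real.exp a / D)
        + 6272 * K₁ * (Real.exp a * l / (δ ^ 3 * y ^ (δ / 14) * D)) := by
  have hD0 : 0 < D := by linarith
  have hy0 : 0 < y := by linarith
  have hDinv : 1 / D ≤ 1 / 4 := one_div_le_one_div_of_le (by norm_num) (by linarith)
  have hDinv0 : 0 < 1 / D := by positivity
  have hA2 : A ≤ K₁ * l ^ 2 := by
    rw [hA, mul_div_assoc]; exact mul_le_mul_of_nonneg_left hδl hK₁0
  have hA0 : 0 ≤ A := by rw [hA]; positivity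
  have hB2 : B ≤ 3 * m * l ^ 2 := by
    have : 1 + D ≤ 3 * l ^ 2 := by nlinarith
    rw [hB]
    calc m * (1 + D) ≤ m * (3 * l ^ 2) := by gcongr
      _ = _ := by ring
  obtain ⟨X, hX⟩ : ∃ X, X = Real.exp a / D := ⟨_, rfl⟩
  obtain ⟨Y, hY⟩ : ∃ Y, Y = Real.exp a * l / (δ ^ 3 * y ^ (δ / 14) * D) := ⟨_, rfl⟩
  rw [← hX, ← hY]
  have hpow : y ^ (κ - α) ≤ 3 * Real.exp a := by
    rw [show κ - α = (a + 1) / D by rw [hκ, hα]; ring, hD, rpow_div_log hyone, Real.exp_add]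
    nlinarith [Real.exp_pos a, Real.exp_one_lt_d9]
  have hX1 : Real.exp a / l ≤ 2 * X := by
    rw [hX, ← mul_div_assoc, div_le_div_iff₀ (by linarith) hD0]
    nlinarith [Real.exp_pos a]
  have hE1 : 4 * (A + B) * y ^ (κ - α) / l ^ 3 ≤ 24 * (K₁ + 3 * m) * X := by
    calc 4 * (A + B) * y ^ (κ - α) / l ^ 3
        ≤ 4 * ((K₁ + 3 * m) * l ^ 2) * (3 * Real.exp a) / l ^ 3 := by gcongr; linarith
      _ = 12 * (K₁ + 3 * m) * (Real.exp a / l) := by field_simp; ring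
      _ ≤ 12 * (K₁ + 3 * m) * (2 * X) := by gcongr
      _ = _ := by ring
  have hE2 : 4 * A * y ^ (κ - α) * (κ - β) / (l ^ 3) ^ 2 ≤ 24 * K₁ * X := by
    have h1 : κ - β ≤ 1 := by linarith
    have h2 : 0 ≤ κ - β := by linarith
    have h3 : 1 / l ^ 4 ≤ 1 / l :=
      one_div_le_one_div_of_le (by linarith) (le_self_pow₀ (by linarith) (by norm_num))
    calc 4 * A * y ^ (κ - α) * (κ - β) / (l ^ 3) ^ 2
        ≤ 4 * (K₁ * l ^ 2) * (3 * Real.exp a) * 1 / (l ^ 3) ^ 2 := by gcongr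
      _ = 12 * K₁ * Real.exp a * (1 / l ^ 4) := by field_simp; ring
      _ ≤ 12 * K₁ * Real.exp a * (1 / l) := by gcongr
      _ = 12 * K₁ * (Real.exp a / l) := by ring
      _ ≤ 12 * K₁ * (2 * X) := by gcongr
      _ = _ := by ring
  -- the factor `y^{-δ/28}` gained beyond `σ = 1 - δ/14` pays for `1 / (δ log y)`
  have hE3 : 4 * Real.pi * A / (α - β) * y ^ (β - α) ≤ 6272 * K₁ * Y := by
    have hab : δ / 14 ≤ α - β := by linarith
    have hyp : y ^ (β - α) ≤ Real.exp a * (28 / (δ * D)) * (y ^ (δ / 14))⁻¹ := by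
      have e : β - α = a / D + -(δ / 28) + -(δ / 14) := by rw [hα, hβ]; ring
      rw [e, Real.rpow_add hy0, Real.rpow_add hy0, Real.rpow_neg hy0.le (δ / 14),
        show y ^ (a / D) = Real.exp a by rw [hD, rpow_div_log hyone]]
      gcongr
      rw [Real.rpow_neg hy0.le, Real.rpow_def_of_pos hy0, ← one_div, ← hD,
        div_le_div_iff₀ (Real.exp_pos _) (by positivity)]
      have := Real.add_one_le_exp (D * (δ / 28))
      linarith
    calc 4 * Real.pi * A / (α - β) * y ^ (β - α)
        ≤ 4 * 4 * A / (δ / 14) * (Real.exp a * (28 / (δ * D)) * (y ^ (δ / 14))⁻¹) := by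
          gcongr
          exact Real.pi_le_four
      _ = 6272 * K₁ * Y := by
          rw [hA, hY]
          have : 0 < y ^ (δ / 14) := by positivity
          field_simp
          ring
  have hE4 : A / y ≤ 2 * K₁ * X := by
    have h1 : (1 : ℝ) ≤ Real.exp a := Real.one_le_exp ha
    calc A / y ≤ K₁ * l ^ 2 / l ^ 4 := by gcongr
      _ = K₁ * (1 / l ^ 2) := by field_simp
      _ ≤ K₁ * (Real.exp a / l) := by
          gcongr
          exact le_self_pow₀ (by linarith) (by norm_num)
      _ ≤ K₁ * (2 * X) := by gcongr
      _ = _ := by ring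
  linarith

/-- `log L(α)` compared with the Riesz mean of its Dirichlet series. -/
lemma norm_log_sub_riesz_le {γ₁ γ₂ C₀ σL δ : ℝ} (hγ₁ : 0 < γ₁) (hγ₂ : 0 < γ₂) (hC₀ : 0 < C₀)
    {N : ℕ} (hN : 16 ≤ N) {L logL : ℂ → ℂ} (hE : HasEulerProduct c L)
    (hC : HasContinuation σL L) (hZ : IsZeroFree σL δ N L)
    (hV : HasConvexityBound γ₁ γ₂ C₀ σL N L) (hlog : IsLogOf c δ N L logL) {y a : ℝ}
    (hy1 : Real.log N ^ (14 / δ) ≤ y) (hy2 : y ≤ (N : ℝ) ^ (2 * Real.pi / 5)) (ha : 0 ≤ a)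
    (ha2 : 28 * a < δ * Real.log y) :
    ‖logL ((1 - a / Real.log y : ℝ) : ℂ)
        - ∑' x, logTerm c x (1 - a / Real.log y : ℝ)
            * ((max (1 - primePow x / y) 0 : ℝ) : ℂ)‖
      ≤ (50 * logConst m γ₁ γ₂ C₀ + 72 * m) * (Real.exp a / Real.log y)
        + 6272 * logConst m γ₁ γ₂ C₀
          * (Real.exp a * Real.log N / (δ ^ 3 * y ^ (δ / 14) * Real.log y)) := by
  have hc := hE.norm_coeff_le
  have hl := log_natCast_ge hN
  have hδ := hZ.pos
  have hδ2 : δ < 7 / 2 := by linarith [hZ.lt, hC.half_le]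
  have hD14 := div_le_log_of_rpow_le hN hδ hy1
  have h4 : 4 ≤ 14 / δ := by rw [le_div_iff₀ hδ]; linarith
  set l := Real.log N with hl_def
  have hyl : l ^ 4 ≤ y := by
    refine le_trans ?_ hy1
    rw [← Real.rpow_natCast]
    exact Real.rpow_le_rpow_of_exponent_le (by linarith) (by push_cast; linarith)
  have hyone : 1 < y := lt_of_lt_of_le (one_lt_pow₀ (by linarith) (by norm_num)) hyl
  have hy0 : 0 < y := by linarith
  have hD2 : Real.log y ≤ 2 * l := log_le_of_le_rpow hN hy0 hy2
  set D := Real.log y with hD_def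
  have hD0 : 0 < D := by linarith
  have hδl : l / δ ≤ l ^ 2 := by
    rw [div_le_iff₀ hδ]
    rw [div_le_iff₀ hδ] at hD14
    nlinarith
  have haD : a / D < δ / 28 := by rw [div_lt_div_iff₀ hD0 (by norm_num)]; linarith
  have haD0 : 0 ≤ a / D := by positivity
  have hDinv : 1 / D ≤ 1 / 4 := one_div_le_one_div_of_le (by norm_num) (by linarith)
  have hDinv0 : 0 < 1 / D := by positivity
  set α := 1 - a / D with hα
  set β := 1 - 3 * δ / 28 with hβ
  set κ := 1 + 1 / D with hκ
  set K₁ := logConst m γ₁ γ₂ C₀ with hK₁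
  have hK₁0 : 0 ≤ K₁ := by
    rw [hK₁, logConst, convexityConst]; positivity
  set A := K₁ * l / δ with hA
  set B := (m : ℝ) * (1 + D) with hB
  have hl3 : 1 ≤ l ^ 3 := one_le_pow₀ (by linarith)
  have hκre : ∀ t : ℝ, ((κ : ℂ) + t * I).re = κ := fun t => by simp
  have hκ1 : 1 < κ := by rw [hκ]; linarith
  have hlineeq : ∀ t : ℝ, logL (κ + t * I) = logSeries c (κ + t * I) := fun t => by
    rw [hlog.eq_series _ (by rw [hκre]; exact hκ1), logSeries_eq hc (by rw [hκre]; exact hκ1)]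
  -- Perron's formula, and the shift of the line of integration from `σ = κ` to `σ = β`
  have hperron := hasSum_riesz_logTerm hc hy0 hκ1 (by linarith : α < κ)
  have hS : ∫ t : ℝ, logL (κ + t * I) * rieszKernel y ((κ - α : ℝ) + t * I)
      = 2 * Real.pi * ∑' x, logTerm c x α * ((max (1 - primePow x / y) 0 : ℝ) : ℂ) := by
    simp only [hlineeq]
    rw [← hperron.tsum_eq, tsum_mul_left]
  have hshift := norm_integral_rieszKernel_sub_le (isOpen_openHalfStrip δ N)
    (hlog.holomorphic.mono (openHalfStrip_subset δ N)) (α := α) (β := β) (κ := κ) (T := l ^ 3)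
    (y := y) (A := A) (B := B) hyone.le (by linarith) (by linarith) (by linarith) hl3
    (fun z h1 _ h3 => ⟨by simp only [mem_ofPred_eq]; linarith,
      by simp only [mem_ofPred_eq]; linarith⟩)
    (fun z h1 h2 h3 => norm_log_le hγ₁ hγ₂ hC₀ hN hE hC hZ hV hlog h1 (by linarith) h3)
    (by
      simp only [hlineeq]
      exact (differentiableOn_logSeries hc).continuousOn.comp_continuous (by fun_prop)
        fun t => by simp only [mem_ofPred_eq]; rw [hκre]; exact hκ1)
    (fun t => by
      rw [hlineeq]
      refine (norm_logSeries_le hc (by rw [hκre]; exact hκ1)).trans (le_of_eq ?_)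
      rw [hκre, hB, hκ]
      simp)
  rw [hS] at hshift
  set S := ∑' x, logTerm c x α * ((max (1 - primePow x / y) 0 : ℝ) : ℂ) with hSdef
  have hαA : ‖logL α‖ ≤ A := norm_log_le hγ₁ hγ₂ hC₀ hN hE hC hZ hV hlog
    (by rw [ofReal_re]; linarith) (by rw [ofReal_re]; linarith)
    (by rw [ofReal_im, abs_zero]; positivity)
  have hdec : ‖logL α - S‖ ≤ ‖2 * Real.pi * S - 2 * Real.pi * ((1 - 1 / y : ℝ) : ℂ) * logL α‖
      + A / y := by
    have e : logL α - S = -(2 * Real.pi * S - 2 * Real.pi * ((1 - 1 / y : ℝ) : ℂ) * logL α)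
        / (2 * Real.pi) + logL α / y := by
      push_cast
      field_simp
      ring
    rw [e]
    refine (norm_add_le _ _).trans (add_le_add ?_ ?_)
    · rw [norm_div, norm_neg]
      refine div_le_self (norm_nonneg _) ?_
      rw [norm_mul, norm_real, Real.norm_of_nonneg Real.pi_pos.le]
      simp only [norm_ofNat]
      linarith [Real.pi_gt_three]
    · rw [norm_div, norm_real, Real.norm_of_nonneg hy0.le]
      gcongr
  refine hdec.trans ?_
  have := shift_error_le hK₁0 (Nat.cast_nonneg m) (by linarith) hδ hδ2 hyone hyl hD_def
    (by linarith) hD2 hδl ha haD hα hβ hκ hA hB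
  linarith

lemma le_errorTerm {N : ℕ} (hN : 16 ≤ N) {δ y : ℝ} (hy : 0 < y) (a : ℝ) :
    Real.exp a / Real.log y
        + Real.exp a * Real.log N / (δ ^ 3 * y ^ (δ / 14) * Real.log y) ≤ errorTerm δ N y a := by
  have hl := log_natCast_ge hN
  have hll := one_le_log_log hN
  have h1 : 0 ≤ Real.log N ^ 2 / (Real.log (Real.log N) * Real.log N ^ (14 / δ)) := by positivity
  have h2 : 0 ≤ y ^ (1 + δ / 14) * Real.log N ^ (δ / 14 + 3 / 2)
      / (δ ^ 2 * (N : ℝ) ^ (Real.pi / 2)) := by positivity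
  rw [errorTerm]
  linarith

lemma norm_log_sub_primeSum_add_C_le {γ₁ γ₂ C₀ σL δ : ℝ} (hγ₁ : 0 < γ₁) (hγ₂ : 0 < γ₂)
    (hC₀ : 0 < C₀) {N : ℕ} (hN : 16 ≤ N) {L logL : ℂ → ℂ} (hE : HasEulerProduct c L)
    (hC : HasContinuation σL L) (hZ : IsZeroFree σL δ N L)
    (hV : HasConvexityBound γ₁ γ₂ C₀ σL N L) (hlog : IsLogOf c δ N L logL) {y a : ℝ}
    (hy1 : Real.log N ^ (14 / δ) ≤ y) (hy2 : y ≤ (N : ℝ) ^ (2 * Real.pi / 5)) (ha : 0 ≤ a)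
    (ha2 : 28 * a < δ * Real.log y) :
    ‖logL ((1 - a / Real.log y : ℝ) : ℂ)
        - (primeSum c y (1 - a / Real.log y) + C c (1 - a / Real.log y))‖
      ≤ (6272 * logConst m γ₁ γ₂ C₀ + 80 * m + 4 * m * properPowerSum) * errorTerm δ N y a := by
  have hc := hE.norm_coeff_le
  have hmain := norm_log_sub_riesz_le hγ₁ hγ₂ hC₀ hN hE hC hZ hV hlog hy1 hy2 ha ha2
  have hl := log_natCast_ge hN
  have hδ := hZ.pos
  have hδ2 : δ < 7 / 2 := by linarith [hZ.lt, hC.half_le]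
  have hD14 := div_le_log_of_rpow_le hN hδ hy1
  have h4 : 4 ≤ 14 / δ := by rw [le_div_iff₀ hδ]; linarith
  have hy0 : 0 < y := lt_of_lt_of_le (Real.rpow_pos_of_pos (by linarith) _) hy1
  set D := Real.log y with hD_def
  have hD0 : 0 < D := by linarith
  have hyone : 1 < y := (Real.log_pos_iff hy0.le).1 hD0
  have haD : a / D < 1 / 8 := by rw [div_lt_div_iff₀ hD0 (by norm_num)]; nlinarith
  have haD0 : 0 ≤ a / D := by positivity
  have hK₁0 : 0 ≤ logConst m γ₁ γ₂ C₀ := by rw [logConst, convexityConst]; positivity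
  have hsum := (hasSum_riesz_logTerm hc hy0 (by norm_num : (1 : ℝ) < 2)
    (by linarith : 1 - a / D < 2)).summable
  rw [summable_mul_left_iff (by simp)] at hsum
  have hriesz := norm_riesz_sub_le hc hyone (by linarith : 7 / 8 ≤ 1 - a / D) (by linarith) hsum
  rw [sub_sub_cancel, hD_def, rpow_div_log hyone, ← hD_def] at hriesz
  set X := Real.exp a / D with hX
  have hexp : (1 : ℝ) ≤ Real.exp a := Real.one_le_exp ha
  have hquarter : y ^ (-(1 / 4) : ℝ) ≤ 4 * X := by
    have := Real.add_one_le_exp (Real.log y * (1 / 4))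
    rw [Real.rpow_neg hy0.le, Real.rpow_def_of_pos hy0, hX, ← mul_div_assoc 4, inv_eq_one_div,
      div_le_div_iff₀ (Real.exp_pos _) hD0]
    nlinarith
  have hP := properPowerSum_nonneg
  have h1 : 8 * m * Real.exp a / D = 8 * m * X := by rw [hX]; ring
  have h2 : m * properPowerSum * y ^ (-(1 / 4) : ℝ) ≤ 4 * m * properPowerSum * X := by
    calc m * properPowerSum * y ^ (-(1 / 4) : ℝ) ≤ m * properPowerSum * (4 * X) := by gcongr
      _ = _ := by ring
  have herr := le_errorTerm hN (δ := δ) hy0 a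
  set Y := Real.exp a * Real.log N / (δ ^ 3 * y ^ (δ / 14) * D) with hY
  have htri := (norm_sub_le_norm_sub_add_norm_sub _ _ _).trans (add_le_add hmain hriesz)
  calc _ ≤ _ := htri
    _ ≤ (50 * logConst m γ₁ γ₂ C₀ + 72 * m) * X + 6272 * logConst m γ₁ γ₂ C₀ * Y
        + (8 * m * X + 4 * m * properPowerSum * X) := by linarith
    _ ≤ (6272 * logConst m γ₁ γ₂ C₀ + 80 * m + 4 * m * properPowerSum) * (X + Y) := by
        have e1 : 0 ≤ 6222 * logConst m γ₁ γ₂ C₀ * X := by positivity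
        have e2 : 0 ≤ (80 * m + 4 * m * properPowerSum) * Y := by positivity
        linarith
    _ ≤ _ := mul_le_mul_of_nonneg_left herr (by positivity)

end GeneralLFunction
end

theorem corollary2 (m : ℕ) (hm : 1 ≤ m) (γ₁ γ₂ C₀ : ℝ) (hγ₁ : 0 < γ₁) (hγ₂ : 0 < γ₂)
    (hC₀ : 0 < C₀) :
    ∃ K : ℝ, 0 < K ∧
      ∀ (σL δ : ℝ) (N : ℕ) (c : Fin m → ℕ → ℂ) (L : ℂ → ℂ),
        16 ≤ N →
        GeneralLFunction.HasEulerProduct c L →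
        GeneralLFunction.HasContinuation σL L →
        GeneralLFunction.IsZeroFree σL δ N L →
        GeneralLFunction.HasConvexityBound γ₁ γ₂ C₀ σL N L →
        (∃ logL : ℂ → ℂ, GeneralLFunction.IsLogOf c δ N L logL) ∧
        ∀ logL : ℂ → ℂ, GeneralLFunction.IsLogOf c δ N L logL →
          ∀ y a : ℝ,
            Real.log N ^ (14 / δ) ≤ y →
            y ≤ (N : ℝ) ^ (2 * Real.pi / 5) →
            0 ≤ a →
            28 * a < δ * Real.log y →
            ‖logL ((1 - a / Real.log y : ℝ) : ℂ)
                - (GeneralLFunction.primeSum c y (1 - a / Real.log y)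
                  + GeneralLFunction.C c (1 - a / Real.log y))‖
              ≤ K * GeneralLFunction.errorTerm δ N y a := by
  refine ⟨6272 * GeneralLFunction.logConst m γ₁ γ₂ C₀ + 80 * m
    + 4 * m * GeneralLFunction.properPowerSum, ?_, ?_⟩
  · have h1 := GeneralLFunction.properPowerSum_nonneg
    rw [GeneralLFunction.logConst, GeneralLFunction.convexityConst]
    positivity
  · intro σL δ N c L hN hE hC hZ hV
    exact ⟨GeneralLFunction.exists_isLogOf hE hC hZ, fun logL hlog y a hy1 hy2 ha ha2 =>
      GeneralLFunction.norm_log_sub_primeSum_add_C_le hγ₁ hγ₂ hC₀ hN hE hC hZ hV hlog hy1 hy2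
        ha ha2⟩
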